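/- **Conventions.** Let $n\ge 1$, $[n]=\{1,\dots,n\}$, and let $K$ be a simplicial complex on $[n]$ without ghost vertices (every $\{i\}$ is a face). $K\backslash\{i\}$ is the full subcomplex of $K$ on $[n]-\{i\}$. $K$ is *$m$-neighbourly* if every set of at most $m$ vertices is a face. Let $D^1=[-1,1]$ with basepoint $-1$, let $S^0=\{-1,1\}$, and let $$W=(D^1,S^0)^K=\{x\in (D^1)^n : \{i : x_i\ne\pm1\}\in K\}.$$ Let $\hat W$ be the image of $W$ in $(D^1)^{\wedge n}$, and for $I\subseteq[n]$ let $W_I$ be the projection of $W$ to the coordinates in $I$ and $\hat W_I$ its image in the smash product of these coordinates. For a partition $(I_1,\dots,I_k)$ of $[n]$, regard $\hat W_{I_1}\wedge\dots\wedge\hat W_{I_k}$ as a subspace of $(D^1)^{\wedge n}$ by permuting coordinates. For $s\in\mathbb R^n$ let $[n]_s=(I_1,\dots,I_k)$ be the ordered partition of $[n]$ into the level sets of $s$, ordered by increasing value. A point of the reduced suspension $\Sigma^{n-1}\hat W$ is written $(t_1,\dots,t_{n-1},x)$ with $t_i\in[-1,1]$ and $x\in\hat W$; it is the basepoint iff some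 $t_i=\pm1$ or $x$ is the basepoint. Call a continuous basepoint-preserving map $\Psi:\Sigma^{n-1}\hat W\to(D^1)^{\wedge n}$ *coherent* for $K$ if 1. $\Psi(0,\dots,0,x)=x$ for all $x\in\hat W$; 2. for all $(t_1,\dots,t_{n-1})\in(-1,1)^{n-1}$ and $x\in\hat W$, one has $\Psi(t_1,\dots,t_{n-1},x)\in\hat W_{I_1}\wedge\dots\wedge\hat W_{I_k}$, where $(I_1,\dots,I_k)=[n]_{(t_1,\dots,t_{n-1},0)}$. $K$ is *coherently homotopy Golod* if it has at most one vertex or, recursively, every $K\backslash\{i\}$ is coherently homotopy Golod and, for some ordering of the vertices of $K$ by $[n]$, there is a coherent map for $K$. $K$ is *extractible* if $K\backslash\{i\}$ is a (possibly empty) simplex for some $i\in[n]$ or, recursively, every $K\backslash\{i\}$ is extractible and the map $\bigvee_{i\in[n]}\Sigma|K\backslash\{i\}|\to\Sigma|K|$ given by the suspended inclusions has a right homotopy inverse (here $\Sigma$ is the unreduced suspension, based at the cone point over $-1$; maps and homotopies are basepoint-preserving). **Statement.** (a) Let $K$ be $\lfloor n/2\rfloor$-neighbourly on $[n]$. Then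 $K$ is coherently homotopy Golod. Moreover, there is a well-defined, continuous, basepoint-preserving map $\Psi_K:\Sigma^{n-1}\hat W\to(D^1)^{\wedge n}$ which is given on every non-basepoint by $$\Psi_K(t_1,\dots,t_{n-1},(x_1,\dots,x_n))=(f_1(x_1),\dots,f_n(x_n)),$$ and $\Psi_K$ is coherent for $K$. Here $t_n=0$, $\beta=\max\{|t_1|,\dots,|t_{n-1}|,0\}$, $$\alpha_i=\min\Big\{\sum_{j\in S}|t_i-t_j| : S\subseteq[n]-\{i\},\ |S|=\lfloor n/2\rfloor\Big\},$$ $$f_i(x_i)=\begin{cases}(1-2\alpha_i\beta)(x_i+1)-1 & \text{if } 0\le\alpha_i<\tfrac12,\\ (1-\beta)(x_i+1)-1 & \text{if }\alpha_i\ge\tfrac12.\end{cases}$$ (b) The complex $(\partial\Delta^2*\partial\Delta^1)\cup_{\partial\Delta^1}\Delta^1$ on 5 vertices is $2$-neighbourly and coherently homotopy Golod, but not extractible. -/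

import Mathlib

open scoped Topology

noncomputable section

namespace HGolod

/-! ### Simplicial complexes

`AbstractSimplicialComplex (Fin n)` is a simplicial complex on the vertex set `[n]` without ghost
vertices (every singleton is a face; only the nonempty faces are recorded). -/

/-- The full subcomplex of `K` along an injection of vertex sets: `σ` is a face iff its image is
a face of `K`. -/
def pullback {ι κ : Type} (f : ι ↪ κ) (K : AbstractSimplicialComplex κ) :
    AbstractSimplicialComplex ι where
  faces := {σ | σ.map f ∈ K.faces}
  isRelLowerSet_faces := by
    intro σ hσ
    refine ⟨Finset.map_nonempty.mp (K.isRelLowerSet_faces hσ).1, ?_⟩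
    intro τ hτ hne
    exact (K.isRelLowerSet_faces hσ).2 (Finset.map_subset_map.mpr hτ)
      (Finset.map_nonempty.mpr hne)
  singleton_mem v := by
    simpa using K.singleton_mem (f v)

/-- `K \ {i}`: the full subcomplex on `[n+1] - {i}`, with the remaining vertices renumbered by
the order-preserving bijection with `[n]`. -/
def delete {n : ℕ} (K : AbstractSimplicialComplex (Fin (n + 1))) (i : Fin (n + 1)) :
    AbstractSimplicialComplex (Fin n) :=
  pullback (Fin.succAboveEmb i) K

/-- `K` with its vertices relabelled by a permutation, i.e. `K` with another vertex ordering. -/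
def relabel {n : ℕ} (K : AbstractSimplicialComplex (Fin n)) (e : Equiv.Perm (Fin n)) :
    AbstractSimplicialComplex (Fin n) :=
  pullback e.toEmbedding K

/-- `K` is `m`-neighbourly: every set of at most `m` vertices is a face. (The empty face is
always understood to be present.) -/
def IsNeighbourly {n : ℕ} (m : ℕ) (K : AbstractSimplicialComplex (Fin n)) : Prop :=
  ∀ σ : Finset (Fin n), σ.Nonempty → σ.card ≤ m → σ ∈ K

/-- The complex `(∂Δ² * ∂Δ¹) ∪ Δ¹` on five vertices, where `Δ²` has the vertices `0, 1, 2` and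
`Δ¹` has the vertices `3, 4`. The faces of the join `∂Δ² * ∂Δ¹` are the unions of a proper
subset of `{0, 1, 2}` and a proper subset of `{3, 4}`. -/
def exampleComplex : AbstractSimplicialComplex (Fin 5) where
  faces := {σ | σ.Nonempty ∧
    ((∃ a b : Finset (Fin 5), a ⊂ {0, 1, 2} ∧ b ⊂ {3, 4} ∧ σ = a ∪ b) ∨ σ ⊆ {3, 4})}
  isRelLowerSet_faces := by
    rintro σ ⟨hne, h⟩
    refine ⟨hne, ?_⟩
    intro τ hτ hτne
    refine ⟨hτne, ?_⟩
    rcases h with ⟨a, b, ha, hb, rfl⟩ | h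
    · left
      refine ⟨τ ∩ a, τ ∩ b, lt_of_le_of_lt Finset.inter_subset_right ha,
        lt_of_le_of_lt Finset.inter_subset_right hb, ?_⟩
      rw [← Finset.inter_union_distrib_left]
      exact (Finset.inter_eq_left.mpr hτ).symm
    · right
      exact Finset.Subset.trans hτ h
  singleton_mem v := by
    refine ⟨Finset.singleton_nonempty v, ?_⟩
    by_cases hv : v ∈ ({3, 4} : Finset (Fin 5))
    · right
      simpa using hv
    · left
      refine ⟨{v}, ∅, ?_, ?_, by simp⟩
      · revert v
        decide
      · decide

/-! ### Spaces -/

/-- The setoid on `X` that identifies all points of `A` with each other. -/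
def collapseSetoid {X : Type} (A : Set X) : Setoid X where
  r x y := x = y ∨ (x ∈ A ∧ y ∈ A)
  iseqv :=
    { refl := fun _ => Or.inl rfl
      symm := by
        rintro x y (h | ⟨h, h'⟩)
        · exact Or.inl h.symm
        · exact Or.inr ⟨h', h⟩
      trans := by
        rintro x y z (rfl | ⟨h, h'⟩) (rfl | ⟨k, k'⟩)
        · exact Or.inl rfl
        · exact Or.inr ⟨k, k'⟩
        · exact Or.inr ⟨h, h'⟩
        · exact Or.inr ⟨h, k'⟩ }

/-- The quotient space `X / A` (for nonempty `A`), with the quotient topology. -/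
abbrev Collapse {X : Type} (A : Set X) : Type := Quotient (collapseSetoid A)

/-- The quotient map `X → X / A`. -/
abbrev Collapse.mk {X : Type} (A : Set X) (x : X) : Collapse A :=
  Quotient.mk (collapseSetoid A) x

/-- `D¹ = [-1, 1]`; its basepoint is `-1`. -/
abbrev D1 : Type := Set.Icc (-1 : ℝ) 1

/-- The point `-1` of `D¹`, its basepoint. -/
def D1.bot : D1 := ⟨-1, by norm_num, by norm_num⟩

/-- The point `0` of `D¹`. -/
def D1.zero : D1 := ⟨0, by norm_num, by norm_num⟩

/-- The point `1` of `D¹`. -/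
def D1.top : D1 := ⟨1, by norm_num, by norm_num⟩

/-- The points of `(D¹)ⁿ` with some coordinate equal to `-1`. -/
def fatWedge (n : ℕ) : Set (Fin n → D1) := {x | ∃ i, x i = D1.bot}

/-- The `n`-fold smash product `(D¹)^{∧ n}` for `n ≥ 1`. -/
abbrev Smash (n : ℕ) : Type := Collapse (fatWedge n)

/-- The quotient map `(D¹)ⁿ → (D¹)^{∧ n}`. -/
abbrev Smash.mk {n : ℕ} (x : Fin n → D1) : Smash n := Collapse.mk (fatWedge n) x

/-- The basepoint of `(D¹)^{∧ n}`. -/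
def Smash.base (n : ℕ) : Smash n := Smash.mk fun _ => D1.bot

/-- The polyhedral product `W = (D¹, S⁰)^K ⊆ (D¹)ⁿ`. -/
def polyProd {n : ℕ} (K : AbstractSimplicialComplex (Fin n)) : Set (Fin n → D1) :=
  {x | ∃ σ ∈ K, ∀ i, i ∉ σ → x i = D1.bot ∨ x i = D1.top}

/-- `Ŵ`: the image of `W` in `(D¹)^{∧ n}`, with the subspace topology. -/
def hatW {n : ℕ} (K : AbstractSimplicialComplex (Fin n)) : Set (Smash n) :=
  Smash.mk '' polyProd K

/-- The subspace `Ŵ_{I₁} ∧ ⋯ ∧ Ŵ_{I_m}` of `(D¹)^{∧ n}` for a partition `(I₁, …, I_m)` of `[n]`: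
the image of all points of `(D¹)ⁿ` whose projection to the coordinates in each block `I_k` lies
in `W_{I_k}`, the image of `W` under the projection to the coordinates in `I_k`. -/
def smashOfBlocks {n : ℕ} (K : AbstractSimplicialComplex (Fin n))
    (P : List (Finset (Fin n))) : Set (Smash n) :=
  Smash.mk '' {x | ∀ I ∈ P, ∃ w ∈ polyProd K, ∀ i ∈ I, w i = x i}

open Classical in
/-- The ordered partition `[n]_s` given by real numbers `s₁, …, s_n`: the `j`-th block consists
of the `ℓ` for which `s_ℓ` is the `j`-th smallest of the distinct values of `s`. -/
def orderedPartition {n : ℕ} (s : Fin n → ℝ) : List (Finset (Fin n)) :=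
  ((Finset.univ.image s).sort (· ≤ ·)).map fun c => Finset.univ.filter fun l => s l = c

/-- The points `(t₁, …, t_m, x)` of `[-1,1]^m × Ŵ` that represent the basepoint of `Σ^m Ŵ`:
some `t_i = ±1`, or `x` is the basepoint. -/
def suspBase {n : ℕ} (m : ℕ) (K : AbstractSimplicialComplex (Fin n)) :
    Set ((Fin m → D1) × hatW K) :=
  {p | (∃ i, p.1 i = D1.bot ∨ p.1 i = D1.top) ∨ (p.2 : Smash n) = Smash.base n}

/-- The `m`-fold reduced suspension `Σ^m Ŵ`. -/
abbrev SuspHatW {n : ℕ} (m : ℕ) (K : AbstractSimplicialComplex (Fin n)) : Type :=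
  Collapse (suspBase m K)

/-- The class of `(t₁, …, t_m, x)` in `Σ^m Ŵ`. -/
abbrev SuspHatW.mk {n m : ℕ} {K : AbstractSimplicialComplex (Fin n)}
    (t : Fin m → D1) (x : hatW K) : SuspHatW m K :=
  Collapse.mk (suspBase m K) (t, x)

/-- The sequence `(t₁, …, t_m, 0)`. -/
def withZero {m : ℕ} (t : Fin m → D1) : Fin (m + 1) → ℝ :=
  Fin.snoc (α := fun _ => ℝ) (fun i => (t i : ℝ)) 0

/-- The requirements on a map `Ψ_K : Σ^{n-1} Ŵ → (D¹)^{∧ n}`, where `n = m + 1`: it preserves the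
basepoint; its restriction to `t₁ = ⋯ = t_{n-1} = 0` is the inclusion of `Ŵ`; and for
`t = (t₁, …, t_{n-1})` in the open cube it maps `{t} ∧ Ŵ` to `Ŵ_{I₁} ∧ ⋯ ∧ Ŵ_{I_k}`,
where `(I₁, …, I_k) = [n]_{(t₁, …, t_{n-1}, 0)}`. -/
structure IsCoherentMap {m : ℕ} (K : AbstractSimplicialComplex (Fin (m + 1)))
    (Ψ : C(SuspHatW m K, Smash (m + 1))) : Prop where
  map_base : ∀ (t : Fin m → D1) (x : hatW K), (t, x) ∈ suspBase m K →
    Ψ (SuspHatW.mk t x) = Smash.base (m + 1)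
  map_zero : ∀ x : hatW K, Ψ (SuspHatW.mk (fun _ => D1.zero) x) = (x : Smash (m + 1))
  map_mem : ∀ t : Fin m → D1, (∀ i, t i ≠ D1.bot ∧ t i ≠ D1.top) → ∀ x : hatW K,
    Ψ (SuspHatW.mk t x) ∈ smashOfBlocks K (orderedPartition (withZero t))

/-- `K` is coherently homotopy Golod: it has at most one vertex, or every `K \ {i}` is coherently
homotopy Golod and for some ordering of the vertices there is a map `Ψ_K` as required above. -/
def CoherentlyHomotopyGolod : (n : ℕ) → AbstractSimplicialComplex (Fin n) → Prop
  | 0, _ => True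
  | 1, _ => True
  | m + 2, K =>
    (∀ i : Fin (m + 2), CoherentlyHomotopyGolod (m + 1) (delete K i)) ∧
      ∃ (e : Equiv.Perm (Fin (m + 2)))
        (Ψ : C(SuspHatW (m + 1) (relabel K e), Smash (m + 2))), IsCoherentMap (relabel K e) Ψ

/-! ### The explicit map for neighbourly complexes -/

/-- `β = max {|t₁|, …, |t_m|, 0}`. -/
def beta {m : ℕ} (t : Fin m → D1) : ℝ :=
  Finset.univ.sup' Finset.univ_nonempty fun i : Fin (m + 1) => |withZero t i|

/-- `α_i = min {∑_{j ∈ S} |t_i - t_j| : S ⊆ [n] - {i}, |S| = ⌊n/2⌋}`, where `n = m + 1` and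
`t_n = 0`. -/
def alpha {m : ℕ} (t : Fin m → D1) (i : Fin (m + 1)) : ℝ :=
  ((Finset.univ.erase i).powersetCard ((m + 1) / 2)).inf'
    (Finset.powersetCard_nonempty.mpr (by
      rw [Finset.card_erase_of_mem (Finset.mem_univ i), Finset.card_univ, Fintype.card_fin]
      omega))
    fun S => ∑ j ∈ S, |withZero t i - withZero t j|

/-- The formula for the coordinates of the map: `(1 - 2αβ)(x + 1) - 1` if `α < 1/2`, and
`(1 - β)(x + 1) - 1` if `α ≥ 1/2`. -/
def coordFormula (α β x : ℝ) : ℝ :=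
  if α < 1 / 2 then (1 - 2 * α * β) * (x + 1) - 1 else (1 - β) * (x + 1) - 1

theorem alpha_nonneg {m : ℕ} (t : Fin m → D1) (i : Fin (m + 1)) : 0 ≤ alpha t i :=
  Finset.le_inf' _ _ fun _ _ => Finset.sum_nonneg fun _ _ => abs_nonneg _

theorem beta_nonneg {m : ℕ} (t : Fin m → D1) : 0 ≤ beta t :=
  le_trans (abs_nonneg (withZero t 0))
    (Finset.le_sup' (fun i : Fin (m + 1) => |withZero t i|) (Finset.mem_univ 0))

theorem beta_le_one {m : ℕ} (t : Fin m → D1) : beta t ≤ 1 := by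
  refine Finset.sup'_le _ _ fun i _ => ?_
  refine Fin.lastCases ?_ (fun j => ?_) i
  · simp [withZero]
  · simpa [withZero] using abs_le.mpr (t j).2

theorem coordFormula_mem {α β x : ℝ} (hα : 0 ≤ α) (hβ : 0 ≤ β) (hβ' : β ≤ 1)
    (hx : x ∈ Set.Icc (-1 : ℝ) 1) : coordFormula α β x ∈ Set.Icc (-1 : ℝ) 1 := by
  obtain ⟨h1, h2⟩ := hx
  have key : ∀ c : ℝ, 0 ≤ c → c ≤ 1 → (1 - c) * (x + 1) - 1 ∈ Set.Icc (-1 : ℝ) 1 := by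
    intro c hc hc'
    constructor <;> nlinarith
  unfold coordFormula
  split_ifs with h
  · exact key (2 * α * β) (by positivity) (by nlinarith)
  · exact key β hβ hβ'

/-- The coordinate `f_i(x_i)` of the map. -/
def psiCoord {m : ℕ} (t : Fin m → D1) (i : Fin (m + 1)) (x : D1) : D1 :=
  ⟨coordFormula (alpha t i) (beta t) x,
    coordFormula_mem (alpha_nonneg t i) (beta_nonneg t) (beta_le_one t) x.2⟩

/-- `Ψ` is given by the explicit formula: the class of a point `(t₁, …, t_{n-1}, (x₁, …, x_n))`
other than the basepoint is mapped to the class of `(f₁(x₁), …, f_n(x_n))`. -/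
def IsExplicitMap {m : ℕ} (K : AbstractSimplicialComplex (Fin (m + 1)))
    (Ψ : C(SuspHatW m K, Smash (m + 1))) : Prop :=
  ∀ t : Fin m → D1, (∀ i, t i ≠ D1.bot ∧ t i ≠ D1.top) →
    ∀ (x : Fin (m + 1) → D1) (hx : x ∈ polyProd K), (∀ i, x i ≠ D1.bot) →
      Ψ (SuspHatW.mk t ⟨Smash.mk x, Set.mem_image_of_mem _ hx⟩) =
        Smash.mk fun i => psiCoord t i (x i)

/-! ### Extractible complexes -/

/-- The geometric realization `|K|` as a subspace of the standard simplex. -/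
def realization {n : ℕ} (K : AbstractSimplicialComplex (Fin n)) : Set (stdSimplex ℝ (Fin n)) :=
  {z | ∃ σ ∈ K, ∀ i, i ∉ σ → z i = 0}

/-- The identifications `(-1, x) ∼ ∗₋₁` and `(1, x) ∼ ∗₁` in the unreduced suspension, where the
cone points `∗₋₁` and `∗₁` are `Sum.inr false` and `Sum.inr true`. -/
inductive SuspRel (X : Type) : (D1 × X) ⊕ Bool → (D1 × X) ⊕ Bool → Prop
  | bot (x : X) : SuspRel X (Sum.inl (D1.bot, x)) (Sum.inr false)
  | top (x : X) : SuspRel X (Sum.inl (D1.top, x)) (Sum.inr true)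

/-- The unreduced suspension `Σ X`, with the quotient topology. -/
abbrev Susp (X : Type) : Type := Quot (SuspRel X)

/-- The basepoint `∗₋₁` of the unreduced suspension. -/
def Susp.base (X : Type) : Susp X := Quot.mk _ (Sum.inr false)

/-- The suspension `Σ f : Σ X → Σ Y` of a map. -/
def Susp.map {X Y : Type} [TopologicalSpace X] [TopologicalSpace Y] (f : C(X, Y)) :
    C(Susp X, Susp Y) where
  toFun := Quot.map (Sum.map (Prod.map id f) id) (by
    rintro _ _ (x | x)
    · exact SuspRel.bot (f x)
    · exact SuspRel.top (f x))
  continuous_toFun := by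
    refine continuous_quot_lift _ (continuous_quot_mk.comp ?_)
    exact (continuous_id.prodMap f.continuous).sumMap continuous_id

/-- The inclusion `|K \ {i}| → |K|`. -/
def deleteIncl {n : ℕ} (K : AbstractSimplicialComplex (Fin (n + 1))) (i : Fin (n + 1)) :
    C(realization (delete K i), realization K) where
  toFun z := ⟨stdSimplex.map i.succAbove z.1, by
    obtain ⟨z, σ, hσ, h⟩ := z
    refine ⟨σ.map (Fin.succAboveEmb i), hσ, fun j hj => ?_⟩
    rw [stdSimplex.map_coe, FunOnFinite.linearMap_apply_apply]
    refine Finset.sum_eq_zero fun k hk => h k fun hkσ => hj ?_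
    rw [Finset.mem_filter] at hk
    exact Finset.mem_map.mpr ⟨k, hkσ, hk.2⟩⟩
  continuous_toFun :=
    ((stdSimplex.continuous_map i.succAbove).comp continuous_subtype_val).subtype_mk _

/-- The basepoints in the disjoint union of the `Σ|K \ {i}|` over all vertices `i`. -/
def wedgeBase {n : ℕ} (K : AbstractSimplicialComplex (Fin (n + 1))) :
    Set (Σ i : Fin (n + 1), Susp (realization (delete K i))) :=
  {p | p.2 = Susp.base _}

/-- The wedge `⋁_i Σ|K \ {i}|` over all vertices `i`. -/
abbrev DeletionWedge {n : ℕ} (K : AbstractSimplicialComplex (Fin (n + 1))) : Type :=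
  Collapse (wedgeBase K)

/-- The basepoint of `⋁_i Σ|K \ {i}|`. -/
def DeletionWedge.base {n : ℕ} (K : AbstractSimplicialComplex (Fin (n + 1))) : DeletionWedge K :=
  Collapse.mk (wedgeBase K) ⟨0, Susp.base _⟩

/-- The map `⋁_i Σ|K \ {i}| → Σ|K|` that is the suspended inclusion on each summand. -/
def wedgeIncl {n : ℕ} (K : AbstractSimplicialComplex (Fin (n + 1))) :
    C(DeletionWedge K, Susp (realization K)) where
  toFun := Quotient.lift (fun p => Susp.map (deleteIncl K p.1) p.2) (by
    have hb : ∀ p ∈ wedgeBase K, Susp.map (deleteIncl K p.1) p.2 = Susp.base _ := by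
      rintro ⟨i, y⟩ hy
      have hy' : y = Susp.base _ := hy
      subst hy'
      rfl
    rintro p q (rfl | ⟨hp, hq⟩)
    · rfl
    · exact (hb p hp).trans (hb q hq).symm)
  continuous_toFun :=
    Continuous.quotient_lift (continuous_sigma fun i => (Susp.map (deleteIncl K i)).continuous) _

/-- The map `⋁_i Σ|K \ {i}| → Σ|K|` has a right homotopy inverse (maps and homotopies preserve
basepoints). -/
def WedgeInclHasRightHomotopyInverse {n : ℕ} (K : AbstractSimplicialComplex (Fin (n + 1))) :
    Prop :=
  ∃ s : C(Susp (realization K), DeletionWedge K),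
    s (Susp.base _) = DeletionWedge.base K ∧
      ((wedgeIncl K).comp s).HomotopicRel (ContinuousMap.id _) {Susp.base _}

/-- `K` is extractible: `K \ {i}` is a simplex (all nonempty sets of its vertices are faces; the
empty complex counts as a simplex) for some vertex `i`, or every `K \ {i}` is extractible and
the wedge of the suspended inclusions has a right homotopy inverse. -/
def Extractible : (n : ℕ) → AbstractSimplicialComplex (Fin n) → Prop
  | 0, _ => True
  | n + 1, K =>
    (∃ i : Fin (n + 1), delete K i = ⊤) ∨
      ((∀ i : Fin (n + 1), Extractible n (delete K i)) ∧ WedgeInclHasRightHomotopyInverse K)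

end HGolod

end

/-!
Part (a). The explicit map scales the coordinate `x_i + 1` by `1 - min (2 α_i) 1 * β`, which is
continuous in all variables and fixes `x_i = -1`, so it passes to `(D¹)^{∧ n}`. If some `t_j = ±1`,
then `β = 1`, and `α_j` or `α_n` is at least `1 / 2` because `|t_j - t_n| = 1`
(`exists_half_le_alpha`, a pigeonhole argument); the corresponding coordinate becomes `-1`, and the
map is well defined on the suspension. For the coherence, take a level set `I` of `(t, 0)`. If `I`
has more than `⌊n / 2⌋` elements, then `α_i = 0` for `i ∈ I`, and the coordinates in `I` do not
change. Otherwise `I` is a face of `K`, and `W` projects onto the whole cube of these coordinates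
(`isCoherentMap_psiMap`). The recursive part of the definition holds because `K \ {i}` is as
neighbourly as `K`.

Part (b). The realization of `K = (∂Δ² * ∂Δ¹) ∪ Δ¹` contains the sphere `|∂Δ² * ∂Δ¹|`, and
`exampleMap : |K| → ℝ³ \ {0}` restricts to an equivalence on this sphere. Its suspension
`Σ|K| → ℝ⁴ \ {0}` is therefore essential (`not_homotopic_const_suspMap`): a contraction could be
turned into a nowhere vanishing vector field on `ℝ⁴` that points outwards far away. Such fields do
not exist (`exists_zero_of_forall_ne_neg_smul`), by the no-retraction theorem, which is proved with
the volume argument of Milnor and Rogers (`not_contDiff_retraction`). On the other hand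
`exampleMap` misses a ray on every `|K \ {i}|`, so that its suspension contracts, relative to the
basepoint, on every `Σ|K \ {i}|` and hence on their wedge (`suspContractionMap`). If the wedge
inclusion had a right homotopy inverse, the suspension of `exampleMap` would factor up to homotopy
through this contractible map (`not_wedgeInclHasRightHomotopyInverse`). Moreover no `K \ {i}` is a
simplex, so `K` is not extractible.
-/

namespace HGolod

open MeasureTheory

/-! ### Retractions of balls and zeros of vector fields -/

/-- As a function of `t`, `det (1 + t A)` is a polynomial of degree at most the dimension. -/
theorem det_one_add_smul_polynomial {E : Type*} [NormedAddCommGroup E] [NormedSpace ℝ E]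
    [FiniteDimensional ℝ E] (A : E →L[ℝ] E) :
    ∃ q : Polynomial ℝ, q.natDegree ≤ Module.finrank ℝ E ∧
      ∀ t : ℝ, q.eval t = (ContinuousLinearMap.id ℝ E + t • A).det := by
  classical
  let b := Module.finBasis ℝ E
  let M : Matrix _ _ ℝ := LinearMap.toMatrix b b (A : E →ₗ[ℝ] E)
  refine ⟨Matrix.det ((Polynomial.X : Polynomial ℝ) • M.map Polynomial.C +
    (1 : Matrix _ _ ℝ).map Polynomial.C), ?_, fun t => ?_⟩
  · simpa using Polynomial.natDegree_det_X_add_C_le M 1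
  · rw [← Polynomial.coe_evalRingHom, RingHom.map_det, ContinuousLinearMap.det,
      ← LinearMap.det_toMatrix b]
    congr 1
    ext i j
    simp [M, Matrix.one_apply, LinearMap.toMatrix_apply, Finsupp.single_apply, eq_comm, add_comm,
      apply_ite]
    exact mul_comm _ _

/-- The integral of `det (1 + t A(x))` over `x` is a polynomial in `t`; if it is constant on an
interval, it is constant. Lagrange interpolation at nodes in the interval expresses the integrand
at `t` through the integrands at the nodes. -/
theorem integral_det_one_add_smul_eq {E : Type*} [NormedAddCommGroup E] [NormedSpace ℝ E]
    [FiniteDimensional ℝ E] [MeasurableSpace E] [BorelSpace E] (μ : Measure E)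
    {s : Set E} (A : E → E →L[ℝ] E) {δ c : ℝ} (hδ : 0 < δ)
    (hint : ∀ t : ℝ, IntegrableOn (fun x => (ContinuousLinearMap.id ℝ E + t • A x).det) s μ)
    (h : ∀ t ∈ Set.Icc 0 δ, ∫ x in s, (ContinuousLinearMap.id ℝ E + t • A x).det ∂μ = c) (t : ℝ) :
    ∫ x in s, (ContinuousLinearMap.id ℝ E + t • A x).det ∂μ = c := by
  classical
  choose q hdeg hq using fun x => det_one_add_smul_polynomial (A x)
  set d := Module.finrank ℝ E
  let v : ℕ → ℝ := fun j => δ * (j / d)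
  have hv : Set.InjOn v (Finset.range (d + 1)) := by
    intro i hi j hj hij
    simp only [v, Finset.coe_range, Set.mem_Iio] at hi hj hij
    rcases Nat.eq_zero_or_pos d with h0 | h0
    · omega
    · have : (0 : ℝ) < d := by exact_mod_cast h0
      have := mul_left_cancel₀ hδ.ne' hij
      field_simp at this
      exact_mod_cast this
  have hvmem : ∀ j ∈ Finset.range (d + 1), v j ∈ Set.Icc 0 δ := by
    intro j hj
    rw [Finset.mem_range] at hj
    refine ⟨by positivity, mul_le_of_le_one_right hδ.le (div_le_one_of_le₀ ?_ (by positivity))⟩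
    exact_mod_cast Nat.lt_succ_iff.mp hj
  have key : ∀ p : Polynomial ℝ, p.natDegree ≤ d →
      p.eval t = ∑ j ∈ Finset.range (d + 1), p.eval (v j) *
        (Lagrange.basis (Finset.range (d + 1)) v j).eval t := by
    intro p hp
    have hdeg : p.degree < (Finset.range (d + 1)).card := by
      rw [Finset.card_range]
      exact lt_of_le_of_lt Polynomial.degree_le_natDegree (by exact_mod_cast Nat.lt_succ_of_le hp)
    conv_lhs => rw [Lagrange.eq_interpolate hv hdeg, Lagrange.interpolate_apply]
    simp [Polynomial.eval_finsetSum]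
  have hsum := key 1 (by simp)
  simp only [Polynomial.eval_one, one_mul] at hsum
  calc ∫ x in s, (ContinuousLinearMap.id ℝ E + t • A x).det ∂μ
      = ∫ x in s, ∑ j ∈ Finset.range (d + 1),
          (ContinuousLinearMap.id ℝ E + v j • A x).det *
            (Lagrange.basis (Finset.range (d + 1)) v j).eval t ∂μ := by
        congr 1
        ext x
        rw [← hq, key _ (hdeg x)]
        simp only [hq]
    _ = ∑ j ∈ Finset.range (d + 1),
          c * (Lagrange.basis (Finset.range (d + 1)) v j).eval t := by
        rw [integral_finsetSum _ fun j _ => (hint _).mul_const _]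
        refine Finset.sum_congr rfl fun j hj => ?_
        rw [integral_mul_const, h _ (hvmem j hj)]
    _ = c := by rw [← Finset.mul_sum, ← hsum, mul_one]


/-- The inverse is found by the contraction principle. -/
theorem bijective_id_add_smul {E : Type*} [NormedAddCommGroup E] [NormedSpace ℝ E]
    [CompleteSpace E] {g : E → E} {L t : ℝ} (hL : 0 ≤ L)
    (hg : ∀ x y, ‖g x - g y‖ ≤ L * ‖x - y‖) (ht : 0 ≤ t) (htL : t * L < 1) :
    Function.Bijective fun x => x + t • g x := by
  have hlip : ∀ x y, ‖t • g x - t • g y‖ ≤ t * L * ‖x - y‖ := by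
    intro x y
    rw [← smul_sub, norm_smul, Real.norm_of_nonneg ht, mul_assoc]
    exact mul_le_mul_of_nonneg_left (hg x y) ht
  constructor
  · intro x y hxy
    have h1 : x - y = t • g y - t • g x := by
      have : x + t • g x = y + t • g y := hxy
      rw [sub_eq_sub_iff_add_eq_add, this, add_comm]
    have h2 := hlip y x
    rw [← h1, norm_sub_rev y x] at h2
    have h3 : ‖x - y‖ = 0 := by
      by_contra h
      have : 0 < ‖x - y‖ := lt_of_le_of_ne (norm_nonneg _) (Ne.symm h)
      nlinarith
    exact sub_eq_zero.mp (norm_eq_zero.mp h3)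
  · intro y
    have hK : ContractingWith ⟨t * L, by positivity⟩ fun x => y - t • g x := by
      refine ⟨by exact_mod_cast htL, LipschitzWith.of_dist_le_mul fun a b => ?_⟩
      rw [dist_eq_norm, dist_eq_norm, sub_sub_sub_cancel_left, norm_sub_rev a b]
      exact hlip b a
    refine ⟨ContractingWith.fixedPoint _ hK, ?_⟩
    have := hK.fixedPoint_isFixedPt
    rw [Function.IsFixedPt, sub_eq_iff_eq_add] at this
    exact this.symm

/-- A `C¹` map `r` of a ball into its boundary sphere cannot restrict to the identity on the
sphere. For small `t` the map `x + t (r x - x)` permutes the ball, so its Jacobian integrates to the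
volume of the ball. The integral is a polynomial in `t`, so the same holds for `t = 1`, where the
Jacobian of `r` is zero. -/
theorem not_contDiff_retraction {E : Type*} [NormedAddCommGroup E] [InnerProductSpace ℝ E]
    [FiniteDimensional ℝ E] {r : E → E} {R : ℝ} (hR : 0 < R) (hr : ContDiff ℝ 1 r)
    (hnorm : ∀ x, ‖r x‖ = R) (hid : ∀ x, ‖x‖ = R → r x = x) : False := by
  classical
  let _ : MeasurableSpace E := borel E
  have _ : BorelSpace E := ⟨rfl⟩
  let μ : Measure E := Measure.addHaar
  let B : Set E := Metric.ball 0 R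
  let g : E → E := fun x => r x - x
  have hgC : ContDiff ℝ 1 g := hr.sub contDiff_id
  have hg0 : ∀ x, ‖x‖ = R → g x = 0 := fun x hx => sub_eq_zero.mpr (hid x hx)
  let A : E → E →L[ℝ] E := fun x => fderiv ℝ g x
  have hA : Continuous A := hgC.continuous_fderiv one_ne_zero
  obtain ⟨L, hL⟩ := (hgC.contDiffOn (s := Metric.closedBall 0 R)).exists_lipschitzOnWith one_ne_zero
    (convex_closedBall 0 R) (isCompact_closedBall 0 R)
  have hL' : ∀ x y : E, ‖x‖ ≤ R → ‖y‖ ≤ R → ‖g x - g y‖ ≤ L * ‖x - y‖ := by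
    intro x y hx hy
    have := hL.dist_le_mul x (by simpa using hx) y (by simpa using hy)
    rwa [dist_eq_norm, dist_eq_norm] at this
  -- The displacement `r x - x` extended by zero outside the ball is still Lipschitz.
  let G : E → E := fun x => if ‖x‖ < R then g x else 0
  have hmix : ∀ x y : E, ‖x‖ < R → R ≤ ‖y‖ → ‖g x‖ ≤ 2 * L * ‖x - y‖ := by
    intro x y hx hy
    have hy0 : 0 < ‖y‖ := hR.trans_le hy
    let p : E := (R / ‖y‖) • y
    have hp : ‖p‖ = R := by
      rw [norm_smul, Real.norm_of_nonneg (by positivity), div_mul_cancel₀ _ hy0.ne']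
    have hyp : ‖y - p‖ = ‖y‖ - R := by
      have : y - p = (1 - R / ‖y‖) • y := by rw [sub_smul, one_smul]
      rw [this, norm_smul, Real.norm_of_nonneg (sub_nonneg.mpr ((div_le_one hy0).mpr hy)), sub_mul,
        one_mul, div_mul_cancel₀ _ hy0.ne']
    have h1 := hL' x p hx.le hp.le
    rw [hg0 p hp, sub_zero] at h1
    have h2 : ‖x - p‖ ≤ ‖x - y‖ + ‖y - p‖ := norm_sub_le_norm_sub_add_norm_sub x y p
    have h3 : ‖y‖ - ‖x‖ ≤ ‖x - y‖ := by
      rw [norm_sub_rev]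
      exact norm_sub_norm_le y x
    have h4 : ‖x - p‖ ≤ 2 * ‖x - y‖ := by linarith
    calc ‖g x‖ ≤ L * ‖x - p‖ := h1
      _ ≤ L * (2 * ‖x - y‖) := mul_le_mul_of_nonneg_left h4 L.2
      _ = _ := by ring
  have hG : ∀ x y, ‖G x - G y‖ ≤ 2 * L * ‖x - y‖ := by
    intro x y
    have hnn : 0 ≤ (L : ℝ) * ‖x - y‖ := by positivity
    by_cases hx : ‖x‖ < R <;> by_cases hy : ‖y‖ < R
    · simp only [G, if_pos hx, if_pos hy]
      linarith [hL' x y hx.le hy.le]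
    · simp only [G, if_pos hx, if_neg hy, sub_zero]
      exact hmix x y hx (not_lt.mp hy)
    · simp only [G, if_neg hx, if_pos hy, zero_sub, norm_neg]
      rw [norm_sub_rev x y]
      exact hmix y x hy (not_lt.mp hx)
    · simp only [G, if_neg hx, if_neg hy, sub_zero, norm_zero]
      linarith
  -- A common `δ` such that `x + t • G x` is bijective with positive Jacobian for `t ∈ [0, δ]`.
  obtain ⟨ε, hε, hdet⟩ : ∃ ε > 0, ∀ T : E →L[ℝ] E, ‖T‖ < ε →
      0 < (ContinuousLinearMap.id ℝ E + T).det := by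
    have hc : Continuous fun T : E →L[ℝ] E => (ContinuousLinearMap.id ℝ E + T).det :=
      ContinuousLinearMap.continuous_det.comp (continuous_const.add continuous_id)
    have h0 : 0 < (ContinuousLinearMap.id ℝ E + (0 : E →L[ℝ] E)).det := by
      rw [add_zero, ContinuousLinearMap.det, ContinuousLinearMap.coe_id, LinearMap.det_id]
      exact one_pos
    obtain ⟨ε, hε, h⟩ := Metric.eventually_nhds_iff.mp (hc.continuousAt.eventually (lt_mem_nhds h0))
    exact ⟨ε, hε, fun T hT => h (by simpa using hT)⟩
  obtain ⟨C, hC⟩ := (isCompact_closedBall (0 : E) R).exists_bound_of_continuousOn hA.continuousOn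
  have hC0 : 0 ≤ C := (norm_nonneg _).trans (hC 0 (by simp [hR.le]))
  obtain ⟨δ, hδ, hδL, hδC⟩ : ∃ δ : ℝ, 0 < δ ∧ δ * (2 * L) < 1 ∧ δ * C < ε := by
    refine ⟨min 1 ε / (2 * L + C + 1), by positivity, ?_, ?_⟩
    · rw [div_mul_eq_mul_div, div_lt_one (by positivity)]
      have : min 1 ε * (2 * L) ≤ 1 * (2 * L) :=
        mul_le_mul_of_nonneg_right (min_le_left _ _) (by positivity)
      linarith
    · rw [div_mul_eq_mul_div, div_lt_iff₀ (by positivity)]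
      have : min 1 ε * C ≤ ε * C := mul_le_mul_of_nonneg_right (min_le_right _ _) hC0
      have : 0 ≤ ε * (2 * L) := by positivity
      nlinarith
  have hint : ∀ t : ℝ, IntegrableOn (fun x => (ContinuousLinearMap.id ℝ E + t • A x).det) B μ := by
    intro t
    have hc : Continuous fun x => (ContinuousLinearMap.id ℝ E + t • A x).det :=
      ContinuousLinearMap.continuous_det.comp (continuous_const.add (hA.const_smul t))
    exact (hc.continuousOn.integrableOn_compact (isCompact_closedBall (0 : E) R)).mono_set
      Metric.ball_subset_closedBall
  have hderiv : ∀ t : ℝ, ∀ x ∈ B, HasFDerivWithinAt (fun x => x + t • G x)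
      (ContinuousLinearMap.id ℝ E + t • A x) B x := by
    intro t x hx
    have h1 : HasFDerivAt (fun x => x + t • g x) (ContinuousLinearMap.id ℝ E + t • A x) x :=
      (hasFDerivAt_id x).add
        (((hgC.differentiable one_ne_zero) x).hasFDerivAt.const_smul t)
    refine h1.hasFDerivWithinAt.congr (fun y hy => ?_) ?_
    · simp only [G, if_pos (mem_ball_zero_iff.mp hy)]
    · simp only [G, if_pos (mem_ball_zero_iff.mp hx)]
  have hsmall : ∀ t ∈ Set.Icc 0 δ,
      ∫ x in B, (ContinuousLinearMap.id ℝ E + t • A x).det ∂μ = μ.real B := by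
    rintro t ⟨ht0, htδ⟩
    have hbij : Function.Bijective fun x => x + t • G x :=
      bijective_id_add_smul (by positivity) hG ht0
        (lt_of_le_of_lt (mul_le_mul_of_nonneg_right htδ (by positivity)) hδL)
    have hout : ∀ x, ¬ ‖x‖ < R → x + t • G x = x := by
      intro x hx
      simp [G, if_neg hx]
    have himg : (fun x => x + t • G x) '' B = B := by
      ext y
      constructor
      · rintro ⟨x, hx, rfl⟩
        refine mem_ball_zero_iff.mpr ?_
        by_contra hcon
        have hfix : x + t • G x = x := hbij.1 (hout _ hcon)
        refine hcon ?_
        simp only [hfix]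
        exact mem_ball_zero_iff.mp hx
      · intro hy
        obtain ⟨x, hx⟩ := hbij.2 y
        refine ⟨x, mem_ball_zero_iff.mpr ?_, hx⟩
        by_contra hcon
        have hx' : x + t • G x = y := hx
        rw [hout x hcon] at hx'
        exact hcon (hx' ▸ mem_ball_zero_iff.mp hy)
    have hcov := integral_image_eq_integral_abs_det_fderiv_smul μ
      (Metric.isOpen_ball (x := (0 : E)) (ε := R)).measurableSet (hderiv t)
      hbij.1.injOn (fun _ => (1 : ℝ))
    rw [show (fun x => x + t • G x) '' Metric.ball 0 R = B from himg] at hcov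
    rw [setIntegral_const, smul_eq_mul, mul_one] at hcov
    rw [hcov]
    refine setIntegral_congr_fun Metric.isOpen_ball.measurableSet fun x hx => ?_
    have hpos : 0 < (ContinuousLinearMap.id ℝ E + t • A x).det := by
      refine hdet _ (lt_of_le_of_lt ?_ hδC)
      rw [norm_smul, Real.norm_of_nonneg ht0]
      exact mul_le_mul htδ (hC x (Metric.ball_subset_closedBall hx)) (norm_nonneg _) hδ.le
    simp only [smul_eq_mul, mul_one]
    exact (abs_of_pos hpos).symm
  have hone := integral_det_one_add_smul_eq μ A hδ hint hsmall 1
  -- At `t = 1` the map is `r`, whose derivative is tangent to a sphere and hence singular.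
  have hzero : ∀ x, (ContinuousLinearMap.id ℝ E + (1 : ℝ) • A x).det = 0 := by
    intro x
    have hrd : HasFDerivAt r (ContinuousLinearMap.id ℝ E + (1 : ℝ) • A x) x := by
      have := (hasFDerivAt_id x).add ((hgC.differentiable one_ne_zero) x).hasFDerivAt
      rw [one_smul]
      refine this.congr_of_eventuallyEq (Filter.Eventually.of_forall fun y => ?_)
      simp [g]
    have hconst : HasFDerivAt (fun y => inner ℝ (r y) (r y)) (0 : E →L[ℝ] ℝ) x := by
      have : (fun y => inner ℝ (r y) (r y)) = fun _ => R ^ 2 := by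
        ext y
        rw [real_inner_self_eq_norm_sq, hnorm]
      rw [this]
      exact hasFDerivAt_const _ _
    have huniq := (hrd.inner ℝ hrd).unique hconst
    by_contra hne
    have hsurj : Function.Surjective (ContinuousLinearMap.id ℝ E + (1 : ℝ) • A x) :=
      (LinearMap.equivOfDetNeZero _ hne).surjective
    obtain ⟨v, hv⟩ := hsurj (r x)
    have := DFunLike.congr_fun huniq v
    simp only [ContinuousLinearMap.comp_apply, ContinuousLinearMap.prod_apply, hv] at this
    rw [fderivInnerCLM_apply] at this
    simp only [real_inner_self_eq_norm_sq, hnorm, zero_apply] at this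
    nlinarith
  simp only [hzero, integral_zero] at hone
  have hpos : 0 < μ.real B := by
    rw [measureReal_def]
    exact ENNReal.toReal_pos (Metric.measure_ball_pos μ 0 hR).ne' measure_ball_lt_top.ne
  exact hpos.ne hone

/-- A continuous vector field whose value at `x` is never a negative multiple of `x` outside a ball
has a zero. Otherwise it could be deformed to the identity outside a larger ball, smoothed and
normalized to a retraction of a ball onto its boundary. -/
theorem exists_zero_of_forall_ne_neg_smul {E : Type*} [NormedAddCommGroup E]
    [InnerProductSpace ℝ E] [FiniteDimensional ℝ E] {f : E → E} {R : ℝ} (hR : 0 < R)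
    (hf : Continuous f) (hout : ∀ x, R ≤ ‖x‖ → ∀ c : ℝ, 0 < c → f x ≠ -(c • x)) :
    ∃ x, f x = 0 := by
  by_contra! hne
  -- The weight with which `f` is deformed to the identity between the radii `R` and `2 * R`.
  let l : E → ℝ := fun x => max 0 (min 1 (‖x‖ / R - 1))
  have hl : Continuous l := by fun_prop
  have hl0 : ∀ x, 0 ≤ l x := fun x => le_max_left _ _
  have hl1 : ∀ x, l x ≤ 1 := fun x => max_le zero_le_one (min_le_left _ _)
  let F : E → E := fun x => (1 - l x) • f x + l x • x
  have hF : Continuous F := by fun_prop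
  have hFne : ∀ x, F x ≠ 0 := by
    intro x hx
    rcases lt_or_ge ‖x‖ R with h | h
    · have : l x = 0 := by
        refine max_eq_left ((min_le_right _ _).trans ?_)
        rw [sub_nonpos, div_le_one hR]
        exact h.le
      simp only [F, this, sub_zero, one_smul, zero_smul, add_zero] at hx
      exact hne x hx
    · have hx0 : x ≠ 0 := by
        rintro rfl
        rw [norm_zero] at h
        linarith
      rcases (hl1 x).eq_or_lt with h1 | h1
      · simp only [F, h1, sub_self, one_smul, zero_smul, zero_add] at hx
        exact hx0 hx
      · rcases (hl0 x).eq_or_lt with h2 | h2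
        · simp only [F, ← h2, sub_zero, one_smul, zero_smul, add_zero] at hx
          exact hne x hx
        · refine hout x h (l x / (1 - l x)) (div_pos h2 (sub_pos.mpr h1)) ?_
          have h3 : (1 - l x) • f x = -(l x • x) := eq_neg_of_add_eq_zero_left hx
          have h4 : 1 - l x ≠ 0 := (sub_pos.mpr h1).ne'
          rw [div_eq_inv_mul, mul_smul, ← smul_neg, ← h3, smul_smul, inv_mul_cancel₀ h4, one_smul]
  have hFid : ∀ x, 2 * R ≤ ‖x‖ → F x = x := by
    intro x hx
    have : l x = 1 := by
      have : (1 : ℝ) ≤ ‖x‖ / R - 1 := by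
        rw [le_sub_iff_add_le, le_div_iff₀ hR]
        linarith
      simp [l, min_eq_left this]
    simp [F, this]
  obtain ⟨φ, hφ, hφF, hφS, -⟩ := hF.exists_contDiff_approx_and_eqOn (ε := fun x => ‖F x‖) 1 hF.norm
    (fun x => norm_pos_iff.mpr (hFne x)) (S := {x | 3 * R ≤ ‖x‖}) (U := {x | 2 * R < ‖x‖})
    (isClosed_le continuous_const continuous_norm)
    ((isOpen_lt continuous_const continuous_norm).mem_nhdsSet.mpr fun x hx => by
      have : 3 * R ≤ ‖x‖ := hx
      show 2 * R < ‖x‖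
      linarith)
    (contDiffOn_id.congr fun x hx => hFid x (le_of_lt hx))
  have hφne : ∀ x, φ x ≠ 0 := by
    intro x hx
    have := hφF x
    rw [hx, dist_zero_left] at this
    exact lt_irrefl _ this
  refine not_contDiff_retraction (r := fun x => (3 * R / ‖φ x‖) • φ x) (R := 3 * R) (by positivity)
    ?_ ?_ ?_
  · exact (contDiff_const.div (hφ.norm ℝ hφne) fun x => norm_ne_zero_iff.mpr (hφne x)).smul hφ
  · intro x
    rw [norm_smul, Real.norm_of_nonneg (by positivity),
      div_mul_cancel₀ _ (norm_ne_zero_iff.mpr (hφne x))]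
  · intro x hx
    have : φ x = x := (hφS (show 3 * R ≤ ‖x‖ from hx.ge)).trans (hFid x (by linarith))
    simp only [this, hx]
    rw [div_self (by positivity), one_smul]

end HGolod

namespace HGolod

/-- Version of `exists_zero_of_forall_ne_neg_smul` for an arbitrary norm. -/
theorem exists_zero_of_forall_ne_neg_smul' {E : Type*} [NormedAddCommGroup E]
    [NormedSpace ℝ E] [FiniteDimensional ℝ E] {f : E → E} {R : ℝ} (hR : 0 < R)
    (hf : Continuous f) (hout : ∀ x, R ≤ ‖x‖ → ∀ c : ℝ, 0 < c → f x ≠ -(c • x)) :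
    ∃ x, f x = 0 := by
  let e : E ≃L[ℝ] EuclideanSpace ℝ (Fin (Module.finrank ℝ E)) := toEuclidean
  let e' : E →L[ℝ] EuclideanSpace ℝ (Fin (Module.finrank ℝ E)) := e
  obtain ⟨y, hy⟩ := exists_zero_of_forall_ne_neg_smul (f := fun y => e (f (e.symm y)))
    (R := ‖e'‖ * R + 1) (by positivity)
    (e.continuous.comp (hf.comp e.symm.continuous)) (fun y hy c hc h => by
      refine hout (e.symm y) ?_ c hc (e.injective ?_)
      · by_contra! hlt
        have h1 := e'.le_opNorm (e.symm y)
        rw [show e' (e.symm y) = y from e.apply_symm_apply y] at h1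
        have h2 := mul_le_mul_of_nonneg_left hlt.le (norm_nonneg e')
        linarith
      · rw [h, map_neg, map_smul, e.apply_symm_apply])
  exact ⟨e.symm y, e.injective (by rw [hy, map_zero])⟩

end HGolod

namespace HGolod

/-! ### The explicit map of a neighbourly complex -/

theorem continuous_withZero {m : ℕ} (i : Fin (m + 1)) :
    Continuous fun t : Fin m → D1 => withZero t i := by
  refine Fin.lastCases ?_ (fun j => ?_) i
  · simpa [withZero] using continuous_const
  · simp only [withZero, Fin.snoc_castSucc]
    exact continuous_subtype_val.comp (continuous_apply j)

theorem continuous_beta {m : ℕ} : Continuous (beta (m := m)) := by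
  unfold beta
  exact Continuous.finset_sup'_apply _ fun i _ => (continuous_withZero i).abs

theorem continuous_alpha {m : ℕ} (i : Fin (m + 1)) :
    Continuous fun t : Fin m → D1 => alpha t i := by
  unfold alpha
  exact Continuous.finset_inf'_apply _ fun S _ => continuous_finsetSum _ fun j _ =>
    ((continuous_withZero i).sub (continuous_withZero j)).abs

/-- The two branches of the coordinate formula agree at `α = 1 / 2`. -/
theorem coordFormula_eq (α β x : ℝ) :
    coordFormula α β x = (1 - min (2 * α) 1 * β) * (x + 1) - 1 := by
  unfold coordFormula
  split_ifs with h
  · rw [min_eq_left (by linarith)]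
  · rw [min_eq_right (by linarith), one_mul]

theorem continuous_psiCoord {m : ℕ} (i : Fin (m + 1)) :
    Continuous fun p : (Fin m → D1) × D1 => psiCoord p.1 i p.2 := by
  refine Continuous.subtype_mk ?_ _
  simp only [coordFormula_eq]
  have hα := (continuous_alpha i).comp (continuous_fst (X := Fin m → D1) (Y := D1))
  have hβ := continuous_beta.comp (continuous_fst (X := Fin m → D1) (Y := D1))
  have hx := continuous_subtype_val.comp (continuous_snd (X := Fin m → D1) (Y := D1))
  exact ((continuous_const.sub (((hα.const_mul 2).min continuous_const).mul hβ)).mul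
    (hx.add continuous_const)).sub continuous_const

theorem psiCoord_bot {m : ℕ} (t : Fin m → D1) (i : Fin (m + 1)) :
    psiCoord t i D1.bot = D1.bot := by
  apply Subtype.ext
  simp [psiCoord, coordFormula, D1.bot]

theorem psiCoord_of_alpha_eq_zero {m : ℕ} {t : Fin m → D1} {i : Fin (m + 1)}
    (h : alpha t i = 0) (x : D1) : psiCoord t i x = x := by
  apply Subtype.ext
  simp [psiCoord, coordFormula, h]

theorem psiCoord_of_beta_eq_zero {m : ℕ} {t : Fin m → D1} (h : beta t = 0) (i : Fin (m + 1))
    (x : D1) : psiCoord t i x = x := by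
  apply Subtype.ext
  simp [psiCoord, coordFormula, h]

theorem psiCoord_eq_bot {m : ℕ} {t : Fin m → D1} {i : Fin (m + 1)}
    (hα : 1 / 2 ≤ alpha t i) (hβ : beta t = 1) (x : D1) : psiCoord t i x = D1.bot := by
  apply Subtype.ext
  simp only [psiCoord, coordFormula, if_neg (not_lt.mpr hα), hβ, D1.bot]
  ring

/-- The smallest distance sums of two indices whose values differ by at least `1` cannot both be
less than `1 / 2`: minimizing sets `S`, `S'` of size `⌊n / 2⌋` that avoid both indices are subsets
of a set with `n - 2` elements, so they share some `k`, and the triangle inequality through `t_k`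
applies. -/
theorem exists_half_le_alpha {m : ℕ} {t : Fin m → D1} {i j : Fin (m + 1)}
    (hij : 1 ≤ |withZero t i - withZero t j|) : 1 / 2 ≤ alpha t i ∨ 1 / 2 ≤ alpha t j := by
  by_contra! h
  obtain ⟨hi, hj⟩ := h
  have hne : i ≠ j := by
    rintro rfl
    simp at hij
    linarith
  rw [alpha, Finset.inf'_lt_iff] at hi hj
  obtain ⟨S, hS, hSi⟩ := hi
  obtain ⟨S', hS', hSj⟩ := hj
  rw [Finset.mem_powersetCard] at hS hS'
  have hle : ∀ (a : Fin (m + 1)) (T : Finset (Fin (m + 1))) (k : Fin (m + 1)), k ∈ T →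
      |withZero t a - withZero t k| ≤ ∑ l ∈ T, |withZero t a - withZero t l| := fun a T k hk =>
    Finset.single_le_sum (f := fun l => |withZero t a - withZero t l|)
      (fun _ _ => abs_nonneg _) hk
  have hjS : j ∉ S := fun hk => by linarith [hle i S j hk]
  have hiS' : i ∉ S' := fun hk => by
    have := hle j S' i hk
    rw [abs_sub_comm] at this
    linarith
  have hdisj : Disjoint S S' := by
    rw [Finset.disjoint_left]
    intro k hk hk'
    have h1 := hle i S k hk
    have h2 := hle j S' k hk'
    rw [abs_sub_comm (withZero t j)] at h2
    linarith [abs_sub_le (withZero t i) (withZero t k) (withZero t j)]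
  have hsub : S ∪ S' ⊆ (Finset.univ.erase i).erase j := by
    intro k hk
    rw [Finset.mem_erase, Finset.mem_erase]
    rcases Finset.mem_union.mp hk with hk | hk
    · exact ⟨fun h => hjS (h ▸ hk), Finset.mem_erase.mp (hS.1 hk)⟩
    · exact ⟨(Finset.mem_erase.mp (hS'.1 hk)).1, fun h => hiS' (h ▸ hk), Finset.mem_univ _⟩
  have hcard := Finset.card_le_card hsub
  rw [Finset.card_union_of_disjoint hdisj, hS.2, hS'.2, Finset.card_erase_of_mem
    (Finset.mem_erase.mpr ⟨hne.symm, Finset.mem_univ _⟩), Finset.card_erase_of_mem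
    (Finset.mem_univ _), Finset.card_univ, Fintype.card_fin] at hcard
  have hval : (i : ℕ) ≠ j := fun h => hne (Fin.ext h)
  omega

/-- On the boundary of the cube the formula sends some coordinate to `-1`, whatever `x` is. -/
theorem exists_psiCoord_eq_bot {m : ℕ} {t : Fin m → D1} {j : Fin m}
    (hj : t j = D1.bot ∨ t j = D1.top) (x : Fin (m + 1) → D1) :
    ∃ i, psiCoord t i (x i) = D1.bot := by
  have habs : |withZero t j.castSucc| = 1 := by
    have : withZero t j.castSucc = t j := by simp [withZero]
    rw [this]
    rcases hj with h | h <;> simp [h, D1.bot, D1.top]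
  have hβ : beta t = 1 := by
    refine le_antisymm (beta_le_one t) ?_
    rw [← habs]
    exact Finset.le_sup' (fun i : Fin (m + 1) => |withZero t i|) (Finset.mem_univ _)
  have hdist : 1 ≤ |withZero t j.castSucc - withZero t (Fin.last m)| := by
    have : withZero t (Fin.last m) = 0 := by simp [withZero]
    rw [this, sub_zero, habs]
  rcases exists_half_le_alpha hdist with h | h
  · exact ⟨_, psiCoord_eq_bot h hβ _⟩
  · exact ⟨_, psiCoord_eq_bot h hβ _⟩

/-- If more than `⌊n / 2⌋` of the values, `t_i` itself included, are equal to `t_i`, then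
`α_i = 0`. -/
theorem alpha_eq_zero {m : ℕ} {t : Fin m → D1} {i : Fin (m + 1)} {I : Finset (Fin (m + 1))}
    (hi : i ∈ I) (hI : ∀ j ∈ I, withZero t j = withZero t i) (hcard : (m + 1) / 2 < I.card) :
    alpha t i = 0 := by
  refine le_antisymm ?_ (alpha_nonneg t i)
  obtain ⟨S, hS, hSc⟩ := Finset.exists_subset_card_eq (s := I.erase i) (n := (m + 1) / 2) (by
    rw [Finset.card_erase_of_mem hi]
    omega)
  refine (Finset.inf'_le _ (b := S) (Finset.mem_powersetCard.mpr
    ⟨hS.trans (Finset.erase_subset_erase i (Finset.subset_univ I)), hSc⟩)).trans ?_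
  refine (Finset.sum_eq_zero fun j hj => ?_).le
  rw [hI j (Finset.mem_of_mem_erase (hS hj)), sub_self, abs_zero]

theorem Smash.mk_eq_base {n : ℕ} {x : Fin n → D1} {i : Fin n} (h : x i = D1.bot) :
    Smash.mk x = Smash.base n :=
  Quotient.sound (Or.inr ⟨⟨i, h⟩, ⟨i, rfl⟩⟩)

theorem Smash.mk_eq_base_iff {n : ℕ} {x : Fin n → D1} (hn : 0 < n) :
    Smash.mk x = Smash.base n ↔ ∃ i, x i = D1.bot := by
  constructor
  · intro h
    rcases Quotient.exact h with h | h
    · exact ⟨⟨0, hn⟩, by rw [h]⟩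
    · exact h.1
  · rintro ⟨i, h⟩
    exact Smash.mk_eq_base h

theorem Smash.continuous_mk {n : ℕ} : Continuous (Smash.mk (n := n)) :=
  continuous_quot_mk

/-- The map `(D¹)ⁿ × [-1,1]^m → (D¹)^{∧ n}` given by the coordinate formula. -/
noncomputable def psiCube (m : ℕ) : C((Fin (m + 1) → D1) × (Fin m → D1), Smash (m + 1)) where
  toFun p := Smash.mk fun i => psiCoord p.2 i (p.1 i)
  continuous_toFun := by
    have h : Continuous fun p : (Fin (m + 1) → D1) × (Fin m → D1) =>
        fun i => psiCoord p.2 i (p.1 i) :=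
      continuous_pi fun i => (continuous_psiCoord i).comp
        (f := fun p : (Fin (m + 1) → D1) × (Fin m → D1) => (p.2, p.1 i)) (by fun_prop)
    exact Smash.continuous_mk.comp h

theorem psiCube_eq_base {m : ℕ} {x : Fin (m + 1) → D1} (hx : x ∈ fatWedge (m + 1))
    (t : Fin m → D1) : psiCube m (x, t) = Smash.base (m + 1) := by
  obtain ⟨i, hi⟩ := hx
  exact Smash.mk_eq_base (i := i) (by simp only [hi, psiCoord_bot])

/-- The self-map of `(D¹)^{∧ n}` given by the coordinate formula for each `t ∈ [-1,1]^m`. It is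
curried so that its continuity passes to the quotient `(D¹)^{∧ n}` of `(D¹)ⁿ`. -/
noncomputable def psiSmash (m : ℕ) : C(Smash (m + 1), C(Fin m → D1, Smash (m + 1))) where
  toFun := Quotient.lift (psiCube m).curry (by
    rintro x y (rfl | ⟨hx, hy⟩)
    · rfl
    · ext1 t
      exact (psiCube_eq_base hx t).trans (psiCube_eq_base hy t).symm)
  continuous_toFun := Continuous.quotient_lift (ContinuousMap.continuous _) _

theorem psiSmash_mk {m : ℕ} (x : Fin (m + 1) → D1) (t : Fin m → D1) :
    psiSmash m (Smash.mk x) t = Smash.mk fun i => psiCoord t i (x i) := rfl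

theorem psiSmash_eq_base {m : ℕ} {K : AbstractSimplicialComplex (Fin (m + 1))}
    {p : (Fin m → D1) × hatW K} (hp : p ∈ suspBase m K) :
    psiSmash m p.2 p.1 = Smash.base (m + 1) := by
  obtain ⟨t, ⟨_, x, hx, rfl⟩⟩ := p
  rw [psiSmash_mk]
  rcases hp with ⟨j, hj⟩ | h
  · obtain ⟨i, hi⟩ := exists_psiCoord_eq_bot hj x
    exact Smash.mk_eq_base hi
  · obtain ⟨i, hi⟩ := (Smash.mk_eq_base_iff m.succ_pos).mp h
    exact Smash.mk_eq_base (i := i) (by rw [hi, psiCoord_bot])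

/-- The map `Ψ_K : Σ^{n-1} Ŵ → (D¹)^{∧ n}` given by the explicit formula. -/
noncomputable def psiMap {m : ℕ} (K : AbstractSimplicialComplex (Fin (m + 1))) :
    C(SuspHatW m K, Smash (m + 1)) where
  toFun := Quotient.lift (fun p => psiSmash m p.2 p.1) (by
    rintro p q (rfl | ⟨hp, hq⟩)
    · rfl
    · exact (psiSmash_eq_base hp).trans (psiSmash_eq_base hq).symm)
  continuous_toFun := by
    refine Continuous.quotient_lift ?_ _
    exact ((psiSmash m).uncurry).continuous.comp
      ((continuous_subtype_val.comp continuous_snd).prodMk continuous_fst)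

theorem isExplicitMap_psiMap {m : ℕ} (K : AbstractSimplicialComplex (Fin (m + 1))) :
    IsExplicitMap K (psiMap K) :=
  fun _ _ _ _ _ => rfl

/-- A block with more than `⌊n / 2⌋` elements is left fixed by the formula, and a smaller block is
a face, over which `W` projects onto the whole cube. -/
theorem isCoherentMap_psiMap {m : ℕ} {K : AbstractSimplicialComplex (Fin (m + 1))}
    (hK : IsNeighbourly ((m + 1) / 2) K) : IsCoherentMap K (psiMap K) where
  map_base _ _ h := psiSmash_eq_base h
  map_zero := by
    rintro ⟨_, x, hx, rfl⟩
    have hβ : beta (fun _ : Fin m => D1.zero) = 0 := by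
      refine le_antisymm (Finset.sup'_le _ _ fun i _ => ?_) (beta_nonneg _)
      refine Fin.lastCases ?_ (fun j => ?_) i <;> simp [withZero, D1.zero]
    show Smash.mk _ = Smash.mk _
    simp only [psiCoord_of_beta_eq_zero hβ]
  map_mem := by
    rintro t - ⟨_, x, hx, rfl⟩
    refine ⟨fun i => psiCoord t i (x i), fun I hI => ?_, rfl⟩
    obtain ⟨c, -, rfl⟩ := List.mem_map.mp hI
    set I : Finset (Fin (m + 1)) := Finset.univ.filter fun l => withZero t l = c with hIdef
    rcases lt_or_ge ((m + 1) / 2) I.card with h | h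
    · refine ⟨x, hx, fun i hi => (psiCoord_of_alpha_eq_zero (alpha_eq_zero hi ?_ h) _).symm⟩
      intro j hj
      rw [hIdef, Finset.mem_filter] at hi hj
      exact hj.2.trans hi.2.symm
    · rcases I.eq_empty_or_nonempty with h0 | h0
      · exact ⟨x, hx, fun i hi => by simp [h0] at hi⟩
      · refine ⟨fun i => if i ∈ I then psiCoord t i (x i) else D1.top,
          ⟨I, hK I h0 h, fun i hi => Or.inr (if_neg hi)⟩, fun i hi => if_pos hi⟩

theorem IsNeighbourly.delete {n m k : ℕ} {K : AbstractSimplicialComplex (Fin (n + 1))}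
    (hK : IsNeighbourly m K) (h : k ≤ m) (i : Fin (n + 1)) : IsNeighbourly k (delete K i) :=
  fun σ hσ hc => hK (σ.map _) (hσ.map) (by rw [Finset.card_map]; exact hc.trans h)

theorem IsNeighbourly.relabel {n m : ℕ} {K : AbstractSimplicialComplex (Fin n)}
    (hK : IsNeighbourly m K) (e : Equiv.Perm (Fin n)) : IsNeighbourly m (relabel K e) :=
  fun σ hσ hc => hK (σ.map _) (hσ.map) (by rw [Finset.card_map]; exact hc)

theorem IsNeighbourly.coherentlyHomotopyGolod : ∀ {n : ℕ} {K : AbstractSimplicialComplex (Fin n)},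
    IsNeighbourly (n / 2) K → CoherentlyHomotopyGolod n K
  | 0, _, _ => trivial
  | 1, _, _ => trivial
  | _ + 2, _, hK =>
    ⟨fun i => (hK.delete (Nat.div_le_div_right (Nat.le_succ _)) i).coherentlyHomotopyGolod,
      1, _, isCoherentMap_psiMap (hK.relabel 1)⟩

end HGolod

namespace HGolod

/-! ### Suspensions of maps into a vector space -/

section Suspension

open scoped unitInterval

variable {U : Type} [NormedAddCommGroup U] [NormedSpace ℝ U] {Z : Type} [TopologicalSpace Z]

/-- The point with height `t` on the arc from `(0, -1)` through `(u, 0)` to `(0, 1)`. -/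
def suspPoint (u : U) (t : ℝ) : U × ℝ := ((1 - t ^ 2) • u, t)

theorem suspPoint_ne_zero {u : U} (hu : u ≠ 0) (t : ℝ) : suspPoint u t ≠ 0 := by
  intro h
  obtain ⟨h1, h2⟩ := Prod.mk_eq_zero.mp h
  rw [h2] at h1
  simp [hu] at h1

theorem suspPoint_eq_of_sq_eq_one {t : ℝ} (ht : t ^ 2 = 1) (u u' : U) :
    suspPoint u t = suspPoint u' t := by
  simp [suspPoint, ht]

@[fun_prop]
theorem continuous_suspPoint : Continuous fun p : U × ℝ => suspPoint p.1 p.2 := by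
  unfold suspPoint
  fun_prop

theorem D1.bot_sq : (D1.bot : ℝ) ^ 2 = 1 := by simp [D1.bot]

theorem D1.top_sq : (D1.top : ℝ) ^ 2 = 1 := by simp [D1.top]

/-- The suspension `Σ Z → (U × ℝ) \ {0}` of a nowhere vanishing map `g : Z → U`. Any `u ≠ 0` can
be used to write down the images of the cone points. -/
def suspMap (g : C(Z, U)) (hg : ∀ z, g z ≠ 0) {u : U} (hu : u ≠ 0) :
    C(Susp Z, {v : U × ℝ // v ≠ 0}) where
  toFun := Quot.lift (Sum.elim (fun p => ⟨suspPoint (g p.2) p.1, suspPoint_ne_zero (hg p.2) _⟩)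
    (fun b => ⟨suspPoint u (cond b D1.top D1.bot : D1), suspPoint_ne_zero hu _⟩)) (by
    rintro _ _ (z | z)
    · exact Subtype.ext (suspPoint_eq_of_sq_eq_one D1.bot_sq _ _)
    · exact Subtype.ext (suspPoint_eq_of_sq_eq_one D1.top_sq _ _))
  continuous_toFun := by
    refine continuous_quot_lift _ (Continuous.sumElim ?_ continuous_of_discreteTopology)
    exact Continuous.subtype_mk (by fun_prop) _

/-- A homotopy from `suspPoint u t` (at `s = 0`) to the lower cone point (at `s = 1`): for
`s ≤ 1 / 2` the segment from `u` to `q` is suspended, for `s ≥ 1 / 2` the height decreases to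
`-1`. -/
def suspContraction (q u : U) (s t : ℝ) : U × ℝ :=
  suspPoint ((1 - min (2 * s) 1) • u + min (2 * s) 1 • q)
    ((1 - max (2 * s - 1) 0) * t - max (2 * s - 1) 0)

theorem suspContraction_ne_zero {q u : U} (hq : q ≠ 0) (hu : ∀ c : ℝ, 0 ≤ c → u ≠ -(c • q))
    {s : ℝ} (hs : 0 ≤ s) (t : ℝ) : suspContraction q u s t ≠ 0 := by
  refine suspPoint_ne_zero (fun h => ?_) _
  have h0 : 0 ≤ min (2 * s) 1 := le_min (by positivity) zero_le_one
  have h1 : min (2 * s) 1 ≤ 1 := min_le_right _ _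
  generalize min (2 * s) 1 = r at h h0 h1
  rcases h1.eq_or_lt with h1 | h1
  · rw [h1, sub_self, zero_smul, one_smul, zero_add] at h
    exact hq h
  · have h2 : 0 < 1 - r := sub_pos.mpr h1
    refine hu (r / (1 - r)) (by positivity) ?_
    rw [div_eq_inv_mul, mul_smul, ← smul_neg, ← eq_neg_of_add_eq_zero_left h, smul_smul,
      inv_mul_cancel₀ h2.ne', one_smul]

theorem suspContraction_zero (q u : U) (t : ℝ) : suspContraction q u 0 t = suspPoint u t := by
  simp [suspContraction]

theorem suspContraction_one (q u : U) (t : ℝ) : suspContraction q u 1 t = (0, -1) := by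
  simp [suspContraction, suspPoint]
  norm_num

theorem suspContraction_bot (q u : U) (s : ℝ) : suspContraction q u s D1.bot = (0, -1) := by
  simp [suspContraction, suspPoint, D1.bot]

theorem suspContraction_top (q u u' : U) (s : ℝ) :
    suspContraction q u s D1.top = suspContraction q u' s D1.top := by
  unfold suspContraction
  rcases le_total (2 * s) 1 with h | h
  · rw [max_eq_right (sub_nonpos.mpr h)]
    exact suspPoint_eq_of_sq_eq_one (by simp [D1.top]) _ _
  · simp [min_eq_right h]

@[fun_prop]
theorem continuous_suspContraction (q : U) :
    Continuous fun p : U × ℝ × ℝ => suspContraction q p.1 p.2.1 p.2.2 := by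
  unfold suspContraction
  fun_prop

/-- The contraction of the suspension of `g : Z → U` for a map `g` that avoids the ray opposite to
`q`, as a family of paths. -/
def suspContractionMap (g : C(Z, U)) {q : U} (hq : q ≠ 0)
    (hg : ∀ z, ∀ c : ℝ, 0 ≤ c → g z ≠ -(c • q)) :
    C(Susp Z, C(I, {v : U × ℝ // v ≠ 0})) where
  toFun := Quot.lift (Sum.elim
    (ContinuousMap.curry ⟨fun p : (D1 × Z) × I =>
      (⟨suspContraction q (g p.1.2) p.2 p.1.1, suspContraction_ne_zero hq (hg _) p.2.2.1 _⟩ :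
        {v : U × ℝ // v ≠ 0}), Continuous.subtype_mk (by fun_prop) _⟩)
    (fun b => ⟨fun s => ⟨suspContraction q q s (cond b D1.top D1.bot : D1),
      suspContraction_ne_zero hq (fun c hc h => by
        have : (1 + c) • q = 0 := by rw [add_smul, one_smul, ← eq_neg_iff_add_eq_zero]; exact h
        rcases smul_eq_zero.mp this with h | h
        · linarith
        · exact hq h) s.2.1 _⟩, Continuous.subtype_mk (by fun_prop) _⟩)) (by
    rintro _ _ (z | z)
    · ext1 s
      exact Subtype.ext ((suspContraction_bot _ _ _).trans (suspContraction_bot _ _ _).symm)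
    · ext1 s
      exact Subtype.ext (suspContraction_top _ _ _ _))
  continuous_toFun := continuous_quot_lift _
    (Continuous.sumElim (ContinuousMap.continuous _) continuous_of_discreteTopology)

theorem suspContractionMap_base (g : C(Z, U)) {q : U} (hq : q ≠ 0)
    (hg : ∀ z, ∀ c : ℝ, 0 ≤ c → g z ≠ -(c • q)) (s : I) :
    (suspContractionMap g hq hg (Susp.base Z) s : U × ℝ) = (0, -1) :=
  suspContraction_bot q q s

theorem suspContractionMap_zero (g : C(Z, U)) {q : U} (hq : q ≠ 0)
    (hg : ∀ z, ∀ c : ℝ, 0 ≤ c → g z ≠ -(c • q)) (hg0 : ∀ z, g z ≠ 0) {u : U} (hu : u ≠ 0)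
    (y : Susp Z) : suspContractionMap g hq hg y 0 = suspMap g hg0 hu y := by
  apply Subtype.ext
  induction y using Quot.ind with
  | mk y =>
    rcases y with ⟨t, z⟩ | b
    · exact suspContraction_zero q (g z) t
    · refine (suspContraction_zero q q _).trans (suspPoint_eq_of_sq_eq_one ?_ _ _)
      cases b
      · exact D1.bot_sq
      · exact D1.top_sq

theorem suspContractionMap_one (g : C(Z, U)) {q : U} (hq : q ≠ 0)
    (hg : ∀ z, ∀ c : ℝ, 0 ≤ c → g z ≠ -(c • q)) (y : Susp Z) :
    (suspContractionMap g hq hg y 1 : U × ℝ) = (0, -1) := by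
  induction y using Quot.ind with
  | mk y =>
    rcases y with ⟨t, z⟩ | b
    · exact suspContraction_one q (g z) t
    · exact suspContraction_one q q _

theorem suspMap_comp_map {Y : Type} [TopologicalSpace Y] (f : C(Y, Z)) (g : C(Z, U))
    (hg : ∀ z, g z ≠ 0) {u : U} (hu : u ≠ 0) (y : Susp Y) :
    suspMap g hg hu (Susp.map f y) = suspMap (g.comp f) (fun y => hg (f y)) hu y := by
  induction y using Quot.ind with
  | mk y => rcases y with y | b <;> rfl

/-- Suppose that `g : Z → U` has a section up to positive scalars: `g (ζ u) = (N u)⁻¹ • u`, where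
`N` behaves like a norm. Then the suspension of `g` does not contract in `(U × ℝ) \ {0}`. The
contraction would give a nowhere vanishing vector field on `U × ℝ`, with the value at `(u, t)`
depending on the time `N u` or `2 |t| - 1`, whichever is larger, that points outwards far away. -/
theorem not_homotopic_const_suspMap [FiniteDimensional ℝ U] [CompactSpace Z] (g : C(Z, U))
    (hg : ∀ z, g z ≠ 0) {u₀ : U} (hu₀ : u₀ ≠ 0) {N : U → ℝ} (hN : Continuous N) (hN0 : N 0 = 0)
    (hN1 : ∀ u, ‖u‖ ≤ N u) {ζ : U → Z} (hζ : ContinuousOn ζ {0}ᶜ)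
    (hgζ : ∀ u, u ≠ 0 → g (ζ u) = (N u)⁻¹ • u) (b : {v : U × ℝ // v ≠ 0}) :
    ¬ (ContinuousMap.const (Susp Z) b).Homotopic (suspMap g hg hu₀) := by
  rintro ⟨H⟩
  let q : C(D1 × Z, Susp Z) := ⟨fun p => Quot.mk _ (Sum.inl p),
    continuous_quot_mk.comp continuous_inl⟩
  let Φ : C((I × D1) × Z, U × ℝ) := ⟨fun p => H (p.1.1, q (p.1.2, p.2)), by fun_prop⟩
  let a : U × ℝ → I × D1 := fun x =>
    (Set.projIcc 0 1 zero_le_one (max (N x.1) (2 * |x.2| - 1)),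
      Set.projIcc (-1) 1 (by norm_num) (2 * x.2))
  have ha : Continuous a := by
    refine (continuous_projIcc.comp ?_).prodMk (continuous_projIcc.comp ?_) <;> fun_prop
  let f : U × ℝ → U × ℝ := fun x => Φ (a x, ζ x.1)
  have hconst : ∀ t z z', Φ (a (0, t), z) = Φ (a (0, t), z') := by
    intro t z z'
    rcases le_total (2 * |t| - 1) 0 with h | h
    · have : (a (0, t)).1 = 0 := by
        simp only [a, hN0, max_eq_left h]
        exact Set.projIcc_left _
      simp [Φ, this]
    · have hq : q ((a (0, t)).2, z) = q ((a (0, t)).2, z') := by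
        rcases le_total t 0 with ht | ht
        · rw [abs_of_nonpos ht] at h
          have : (a (0, t)).2 = D1.bot := Set.projIcc_of_le_left (by norm_num) (by linarith)
          rw [this]
          exact (Quot.sound (SuspRel.bot z)).trans (Quot.sound (SuspRel.bot z')).symm
        · rw [abs_of_nonneg ht] at h
          have : (a (0, t)).2 = D1.top := Set.projIcc_of_right_le (by norm_num) (by linarith)
          rw [this]
          exact (Quot.sound (SuspRel.top z)).trans (Quot.sound (SuspRel.top z')).symm
      simp only [Φ, ContinuousMap.coe_mk, hq]
  have hf : Continuous f := by
    rw [continuous_iff_continuousAt]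
    rintro ⟨u, t⟩
    by_cases hu : u = 0
    · subst hu
      -- Near `u = 0` the value of `ζ` is irrelevant, by uniformity over the compact space `Z`.
      have h1 : Filter.Tendsto (fun x => dist (Φ.curry (a x)) (Φ.curry (a (0, t)))) (𝓝 (0, t))
          (𝓝 0) := by
        have hc : Continuous fun x => dist (Φ.curry (a x)) (Φ.curry (a (0, t))) :=
          (Φ.curry.continuous.comp ha).dist continuous_const
        simpa using hc.tendsto (0, t)
      rw [ContinuousAt, tendsto_iff_dist_tendsto_zero]
      refine squeeze_zero (fun _ => dist_nonneg) (fun x => ?_) h1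
      have : f (0, t) = Φ.curry (a (0, t)) (ζ x.1) := hconst t _ _
      rw [this]
      exact ContinuousMap.dist_apply_le_dist (f := Φ.curry (a x)) _
    · have h1 : ContinuousAt ζ u := hζ.continuousAt (isOpen_compl_singleton.mem_nhds hu)
      have h2 : ContinuousAt (fun x : U × ℝ => (a x, ζ x.1)) (u, t) :=
        ha.continuousAt.prodMk (h1.comp (f := Prod.fst) (x := (u, t)) continuousAt_fst)
      exact Φ.continuous.continuousAt.comp h2
  obtain ⟨x, hx⟩ := exists_zero_of_forall_ne_neg_smul' one_pos hf (by
    rintro ⟨u, t⟩ hx c hc h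
    have hs : (a (u, t)).1 = 1 := by
      refine Set.projIcc_of_right_le zero_le_one ?_
      rcases le_max_iff.mp hx with h | h
      · exact le_max_of_le_left (h.trans (hN1 u))
      · have : 1 ≤ |t| := h
        exact le_max_of_le_right (by linarith)
    have hval : f (u, t) = suspPoint (g (ζ u)) (a (u, t)).2 := by
      simp only [f, Φ, ContinuousMap.coe_mk, hs, ContinuousMap.Homotopy.apply_one]
      rfl
    rw [hval] at h
    have h2 : ((a (u, t)).2 : ℝ) = -(c * t) := congrArg Prod.snd h
    have hτ : ((a (u, t)).2 : ℝ) = max (-1) (min 1 (2 * t)) := Set.coe_projIcc _ _ (by norm_num) _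
    have ht : t = 0 := by
      rcases lt_trichotomy t 0 with ht | ht | ht
      · have h3 : ((a (u, t)).2 : ℝ) < 0 := by
          rw [hτ]
          exact max_lt (by norm_num) ((min_le_right _ _).trans_lt (by linarith))
        nlinarith
      · exact ht
      · have h3 : 0 < ((a (u, t)).2 : ℝ) := by
          rw [hτ]
          exact lt_max_of_lt_right (lt_min one_pos (by linarith))
        nlinarith
    have hu : u ≠ 0 := by
      rintro rfl
      rw [ht] at hx
      simp at hx
      linarith
    have h1 : (1 - ((a (u, t)).2 : ℝ) ^ 2) • g (ζ u) = -(c • u) := congrArg Prod.fst h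
    rw [h2, ht, hgζ u hu, mul_zero, neg_zero, zero_pow two_ne_zero, sub_zero, one_smul,
      ← add_eq_zero_iff_eq_neg, ← add_smul] at h1
    have hNpos : 0 < N u := (norm_pos_iff.mpr hu).trans_le (hN1 u)
    rcases smul_eq_zero.mp h1 with h1 | h1
    · have := inv_pos.mpr hNpos
      linarith
    · exact hu h1)
  exact (H _).2 hx

end Suspension

end HGolod

namespace HGolod

/-! ### The complex `(∂Δ² * ∂Δ¹) ∪ Δ¹` -/

theorem mem_exampleComplex_iff {σ : Finset (Fin 5)} :
    σ ∈ exampleComplex ↔ σ.Nonempty ∧ ((¬ {0, 1, 2} ⊆ σ ∧ ¬ {3, 4} ⊆ σ) ∨ σ ⊆ {3, 4}) := by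
  have hdisj : Disjoint ({0, 1, 2} : Finset (Fin 5)) {3, 4} := by decide
  show (σ.Nonempty ∧ _) ↔ _
  refine and_congr_right fun _ => or_congr_left ⟨?_, ?_⟩
  · rintro ⟨a, b, ha, hb, rfl⟩
    constructor
    · intro h
      exact ha.2 ((hdisj.mono_right hb.1).left_le_of_le_sup_right h)
    · intro h
      exact hb.2 ((hdisj.symm.mono_right ha.1).left_le_of_le_sup_left h)
  · rintro ⟨h1, h2⟩
    refine ⟨σ ∩ {0, 1, 2}, σ ∩ {3, 4}, ⟨Finset.inter_subset_right, fun h => ?_⟩,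
      ⟨Finset.inter_subset_right, fun h => ?_⟩, ?_⟩
    · exact h1 (h.trans Finset.inter_subset_left)
    · exact h2 (h.trans Finset.inter_subset_left)
    · rw [← Finset.inter_union_distrib_left,
        show ({0, 1, 2} ∪ {3, 4} : Finset (Fin 5)) = Finset.univ by decide, Finset.inter_univ]

theorem isNeighbourly_exampleComplex : IsNeighbourly (5 / 2) exampleComplex := by
  intro σ hσ hc
  rw [mem_exampleComplex_iff]
  revert σ
  decide

theorem delete_exampleComplex_ne_top (i : Fin 5) : delete exampleComplex i ≠ ⊤ := by
  intro h
  have hmem : (Finset.univ : Finset (Fin 4)) ∈ delete exampleComplex i := by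
    rw [h]
    exact Finset.univ_nonempty
  have hmem' : Finset.univ.map (Fin.succAboveEmb i) ∈ exampleComplex := hmem
  rw [mem_exampleComplex_iff] at hmem'
  clear h hmem
  revert i
  decide

theorem isClosed_realization {n : ℕ} (K : AbstractSimplicialComplex (Fin n)) :
    IsClosed (realization K) := by
  have : realization K = ⋃ σ ∈ (K : Set (Finset (Fin n))), {z | ∀ i, i ∉ σ → z i = 0} := by
    ext z
    simp [realization]
  rw [this]
  refine (Set.toFinite _).isClosed_biUnion fun σ _ => ?_
  simp only [Set.ofPred_forall]
  refine isClosed_iInter fun i => isClosed_iInter fun _ => isClosed_eq ?_ continuous_const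
  exact (continuous_apply i).comp continuous_subtype_val

instance {n : ℕ} (K : AbstractSimplicialComplex (Fin n)) : CompactSpace (realization K) :=
  isCompact_iff_compactSpace.mp (isClosed_realization K).isCompact

theorem deleteIncl_apply_self {n : ℕ} (K : AbstractSimplicialComplex (Fin (n + 1)))
    (i : Fin (n + 1)) (y : realization (delete K i)) : (deleteIncl K i y).1 i = 0 := by
  show stdSimplex.map i.succAbove y.1 i = 0
  rw [stdSimplex.map_coe, FunOnFinite.linearMap_apply_apply]
  refine Finset.sum_eq_zero fun k hk => ?_
  exact absurd (Finset.mem_filter.mp hk).2 (Fin.succAbove_ne i k)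

/-- If the suspension `Σ|K| → (U × ℝ) \ {0}` of `g` is essential, although `g` misses a ray on each
`|K \ {i}|`, then `⋁_i Σ|K \ {i}| → Σ|K|` has no right homotopy inverse `s`: the suspension of `g`
contracts on the wedge, and it is homotopic to its composite with the wedge map and `s`. -/
theorem not_wedgeInclHasRightHomotopyInverse {n : ℕ} {K : AbstractSimplicialComplex (Fin (n + 1))}
    {U : Type} [NormedAddCommGroup U] [NormedSpace ℝ U] (g : C(realization K, U))
    (hg : ∀ z, g z ≠ 0) {q : Fin (n + 1) → U} (hq : ∀ i, q i ≠ 0)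
    (hgq : ∀ i (y : realization (delete K i)) (c : ℝ), 0 ≤ c →
      g (deleteIncl K i y) ≠ -(c • q i))
    (hess : ∀ b : {v : U × ℝ // v ≠ 0},
      ¬ (ContinuousMap.const (Susp (realization K)) b).Homotopic (suspMap g hg (hq 0))) :
    ¬ WedgeInclHasRightHomotopyInverse K := by
  rintro ⟨s, -, hs⟩
  let ν : C(DeletionWedge K, C(unitInterval, {v : U × ℝ // v ≠ 0})) :=
    { toFun := Quotient.lift
        (fun p => suspContractionMap (g.comp (deleteIncl K p.1)) (hq p.1) (hgq p.1) p.2) (by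
          have hb : ∀ p ∈ wedgeBase K, ∀ r, (suspContractionMap (g.comp (deleteIncl K p.1))
              (hq p.1) (hgq p.1) p.2 r : U × ℝ) = (0, -1) := by
            rintro ⟨i, y⟩ hy r
            have hy' : y = Susp.base _ := hy
            subst hy'
            exact suspContractionMap_base _ _ _ r
          rintro p p' (rfl | ⟨hp, hp'⟩)
          · rfl
          · ext1 r
            exact Subtype.ext ((hb p hp r).trans (hb p' hp' r).symm))
      continuous_toFun := Continuous.quotient_lift
        (continuous_sigma fun i => (suspContractionMap (g.comp (deleteIncl K i)) (hq i)
          (hgq i)).continuous) _ }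
  let b : {v : U × ℝ // v ≠ 0} := ⟨(0, -1), by simp⟩
  have hnull : ((suspMap g hg (hq 0)).comp (wedgeIncl K)).Homotopic (ContinuousMap.const _ b) := by
    refine ⟨⟨⟨fun p => ν p.2 p.1, by fun_prop⟩, fun w => ?_, fun w => ?_⟩⟩
    · obtain ⟨⟨i, y⟩, rfl⟩ := Quotient.exists_rep w
      refine (suspContractionMap_zero (g.comp (deleteIncl K i)) (hq i) (hgq i)
        (fun y => hg _) (hq 0) y).trans ?_
      exact (suspMap_comp_map (deleteIncl K i) g hg (hq 0) y).symm
    · obtain ⟨⟨i, y⟩, rfl⟩ := Quotient.exists_rep w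
      exact Subtype.ext (suspContractionMap_one (g.comp (deleteIncl K i)) (hq i) (hgq i) y)
  refine hess b ?_
  have h1 := (ContinuousMap.Homotopic.refl (suspMap g hg (hq 0))).comp hs.homotopic
  have h2 := hnull.comp (ContinuousMap.Homotopic.refl s)
  exact (h1.symm.trans h2).symm

/-- The map `|K| → ℝ³` that sends the vertices of `Δ²` to `e₁`, `e₂`, `-e₁ - e₂` and those of
`Δ¹` to `±e₃`, affinely on the faces of `∂Δ² * ∂Δ¹`. The summand `z₃ z₄` vanishes on these faces;
it makes the additional edge avoid the origin. -/
def exampleMap : C(realization exampleComplex, Fin 3 → ℝ) where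
  toFun z := ![z.1 0 + z.1 3 * z.1 4 - z.1 2, z.1 1 - z.1 2, z.1 3 - z.1 4]
  continuous_toFun := by
    have h : ∀ i, Continuous fun z : realization exampleComplex => z.1 i := fun i =>
      (continuous_apply i).comp (continuous_subtype_val.comp continuous_subtype_val)
    refine continuous_pi fun j => ?_
    fin_cases j
    · exact ((h 0).add ((h 3).mul (h 4))).sub (h 2)
    · exact (h 1).sub (h 2)
    · exact (h 3).sub (h 4)

theorem realization_exampleComplex_cases (z : realization exampleComplex) :
    ((z.1 0 = 0 ∨ z.1 1 = 0 ∨ z.1 2 = 0) ∧ (z.1 3 = 0 ∨ z.1 4 = 0)) ∨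
      (z.1 0 = 0 ∧ z.1 1 = 0 ∧ z.1 2 = 0) := by
  obtain ⟨z, σ, hσ, h⟩ := z
  rcases (mem_exampleComplex_iff.mp hσ).2 with ⟨h1, h2⟩ | h1
  · left
    simp only [Finset.insert_subset_iff, Finset.singleton_subset_iff, not_and_or] at h1 h2
    exact ⟨h1.imp (h 0) (Or.imp (h 1) (h 2)), h2.imp (h 3) (h 4)⟩
  · right
    exact ⟨h 0 fun h => absurd (h1 h) (by decide), h 1 fun h => absurd (h1 h) (by decide),
      h 2 fun h => absurd (h1 h) (by decide)⟩

theorem stdSimplex_five (z : stdSimplex ℝ (Fin 5)) :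
    (∀ i, 0 ≤ z i) ∧ z 0 + z 1 + z 2 + z 3 + z 4 = 1 := by
  refine ⟨z.2.1, ?_⟩
  have := z.2.2
  rw [Fin.sum_univ_five] at this
  exact this

/-- The only point of `|K|` in the direction of `(1, 1, 1)` is the barycentre of the face
`{0, 1, 3}`. -/
theorem exampleMap_eq_pos {z : realization exampleComplex} {c : ℝ} (hc : 0 ≤ c)
    (h : exampleMap z = fun _ => c) : 0 < z.1 0 ∧ 0 < z.1 1 ∧ 0 < z.1 3 := by
  obtain ⟨hz, hsum⟩ := stdSimplex_five z.1
  have h0 : z.1 0 + z.1 3 * z.1 4 - z.1 2 = c := congrFun h 0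
  have h1 : z.1 1 - z.1 2 = c := congrFun h 1
  have h3 : z.1 3 - z.1 4 = c := congrFun h 2
  have := hz 0
  have := hz 1
  have := hz 2
  have := hz 3
  have := hz 4
  rcases realization_exampleComplex_cases z with ⟨ha, hb⟩ | ⟨ha0, ha1, ha2⟩
  · have h4 : z.1 4 = 0 := by rcases hb with hb | hb <;> linarith
    rw [h4, mul_zero] at h0
    have h2 : z.1 2 = 0 := by rcases ha with ha | ha | ha <;> linarith
    refine ⟨?_, ?_, ?_⟩ <;> linarith
  · have h34 : z.1 3 = z.1 4 := by linarith
    rw [← h34] at h0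
    have : z.1 3 = 0 := by nlinarith
    linarith

/-- The only point of `|K|` in the direction of `(-1, -1, -1)` is the midpoint of the face
`{2, 4}`. -/
theorem exampleMap_eq_neg {z : realization exampleComplex} {c : ℝ} (hc : 0 ≤ c)
    (h : exampleMap z = fun _ => -c) : 0 < z.1 2 ∧ 0 < z.1 4 := by
  obtain ⟨hz, hsum⟩ := stdSimplex_five z.1
  have h0 : z.1 0 + z.1 3 * z.1 4 - z.1 2 = -c := congrFun h 0
  have h1 : z.1 1 - z.1 2 = -c := congrFun h 1
  have h3 : z.1 3 - z.1 4 = -c := congrFun h 2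
  have := hz 0
  have := hz 1
  have := hz 2
  have := hz 3
  have := hz 4
  rcases realization_exampleComplex_cases z with ⟨ha, hb⟩ | ⟨ha0, ha1, ha2⟩
  · have h4 : z.1 3 = 0 := by rcases hb with hb | hb <;> linarith
    rw [h4, zero_mul] at h0
    have h2 : z.1 0 = 0 := by rcases ha with ha | ha | ha <;> linarith
    refine ⟨?_, ?_⟩ <;> linarith
  · have h34 : z.1 3 = z.1 4 := by linarith
    rw [← h34] at h0
    have : z.1 3 = 0 := by nlinarith
    linarith

theorem exampleMap_ne_zero (z : realization exampleComplex) : exampleMap z ≠ 0 := by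
  intro h
  obtain ⟨h0, h1, h3⟩ := exampleMap_eq_pos le_rfl h
  obtain ⟨h2, h4⟩ := exampleMap_eq_neg le_rfl (h.trans (by ext; simp))
  rcases realization_exampleComplex_cases z with ⟨-, h | h⟩ | ⟨h, -, -⟩ <;> linarith

/-- The direction opposite to one that `exampleMap` misses on `|K \ {i}|`. -/
def exampleDir (i : Fin 5) : Fin 3 → ℝ := fun _ => if i = 2 ∨ i = 4 then 1 else -1

theorem exampleDir_ne_zero (i : Fin 5) : exampleDir i ≠ 0 := by
  intro h
  have := congrFun h 0
  simp only [exampleDir, Pi.zero_apply] at this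
  split_ifs at this <;> norm_num at this

theorem exampleMap_deleteIncl_ne (i : Fin 5) (y : realization (delete exampleComplex i)) (c : ℝ)
    (hc : 0 ≤ c) : exampleMap (deleteIncl exampleComplex i y) ≠ -(c • exampleDir i) := by
  intro h
  have hi := deleteIncl_apply_self exampleComplex i y
  by_cases h24 : i = 2 ∨ i = 4
  · have := exampleMap_eq_neg hc (h.trans (by ext; simp [exampleDir, h24]))
    rcases h24 with rfl | rfl
    · exact this.1.ne' hi
    · exact this.2.ne' hi
  · have := exampleMap_eq_pos hc (h.trans (by ext; simp [exampleDir, h24]))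
    fin_cases i
    · exact this.1.ne' hi
    · exact this.2.1.ne' hi
    · exact h24 (Or.inl rfl)
    · exact this.2.2.ne' hi
    · exact h24 (Or.inr rfl)

/-- Barycentric coordinates, up to scaling, of the point of `|∂Δ² * ∂Δ¹|` that `exampleMap` sends
to the direction of `u`. -/
def exampleCoord (u : Fin 3 → ℝ) : Fin 5 → ℝ :=
  ![u 0 - min (min (u 0) (u 1)) 0, u 1 - min (min (u 0) (u 1)) 0, - min (min (u 0) (u 1)) 0,
    max (u 2) 0, max (-u 2) 0]

theorem continuous_exampleCoord : Continuous exampleCoord := by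
  refine continuous_pi fun i => ?_
  fin_cases i <;> simp [exampleCoord] <;> fun_prop

theorem exampleCoord_nonneg (u : Fin 3 → ℝ) (i : Fin 5) : 0 ≤ exampleCoord u i := by
  fin_cases i <;> simp [exampleCoord]

theorem exampleCoord_three_sub_four (u : Fin 3 → ℝ) :
    exampleCoord u 3 - exampleCoord u 4 = u 2 := by
  simp only [exampleCoord, Matrix.cons_val]
  rcases le_total (u 2) 0 with h | h <;> simp [h]

theorem norm_le_sum_exampleCoord (u : Fin 3 → ℝ) : ‖u‖ ≤ ∑ i, exampleCoord u i := by
  have hnn := exampleCoord_nonneg u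
  refine (pi_norm_le_iff_of_nonneg (Finset.sum_nonneg fun i _ => hnn i)).mpr fun j => ?_
  rw [Real.norm_eq_abs, abs_le, Fin.sum_univ_five]
  have h0 := hnn 0
  have h1 := hnn 1
  have h2 := hnn 2
  have h3 := hnn 3
  have h4 := hnn 4
  have e0 : u 0 = exampleCoord u 0 - exampleCoord u 2 := by simp [exampleCoord]
  have e1 : u 1 = exampleCoord u 1 - exampleCoord u 2 := by simp [exampleCoord]
  have e2 : u 2 = exampleCoord u 3 - exampleCoord u 4 := (exampleCoord_three_sub_four u).symm
  fin_cases j <;> simp only [Fin.zero_eta, Fin.mk_one, Fin.reduceFinMk, e0, e1, e2] <;>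
    constructor <;> linarith

/-- The inverse, up to positive scalars, of `exampleMap` on `|∂Δ² * ∂Δ¹|`. -/
theorem exists_exampleMap_section : ∃ ζ : (Fin 3 → ℝ) → realization exampleComplex,
    ContinuousOn ζ {0}ᶜ ∧
      ∀ u, u ≠ 0 → exampleMap (ζ u) = (∑ i, exampleCoord u i)⁻¹ • u := by
  have hpos : ∀ u : Fin 3 → ℝ, u ≠ 0 → 0 < ∑ i, exampleCoord u i := fun u hu =>
    (norm_pos_iff.mpr hu).trans_le (norm_le_sum_exampleCoord u)
  have hex : ∀ u : Fin 3 → ℝ, u ≠ 0 → ∃ z : realization exampleComplex,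
      ∀ i, z.1 i = (∑ i, exampleCoord u i)⁻¹ * exampleCoord u i := by
    intro u hu
    have hs : ∑ i, (∑ i, exampleCoord u i)⁻¹ * exampleCoord u i = 1 := by
      rw [← Finset.mul_sum, inv_mul_cancel₀ (hpos u hu).ne']
    refine ⟨⟨⟨fun i => (∑ i, exampleCoord u i)⁻¹ * exampleCoord u i, fun i =>
      mul_nonneg (inv_nonneg.mpr (hpos u hu).le) (exampleCoord_nonneg u i), hs⟩,
      Finset.univ.filter fun i => exampleCoord u i ≠ 0, ?_, fun i hi => ?_⟩, fun i => rfl⟩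
    · -- The coordinates of each of `Δ²` and `Δ¹` have minimum `0`, so the support is a face.
      rw [mem_exampleComplex_iff]
      refine ⟨?_, Or.inl ⟨fun h => ?_, fun h => ?_⟩⟩
      · obtain ⟨i, -, hi⟩ := Finset.exists_ne_zero_of_sum_ne_zero (hpos u hu).ne'
        exact ⟨i, Finset.mem_filter.mpr ⟨Finset.mem_univ i, hi⟩⟩
      · simp only [Finset.insert_subset_iff, Finset.singleton_subset_iff, Finset.mem_filter,
          Finset.mem_univ, true_and] at h
        obtain ⟨h0, h1, h2⟩ := h
        simp only [exampleCoord, Matrix.cons_val] at h0 h1 h2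
        rcases min_choice (min (u 0) (u 1)) 0 with h | h
        · rcases min_choice (u 0) (u 1) with h' | h'
          · exact h0 (by rw [h, h', sub_self])
          · exact h1 (by rw [h, h', sub_self])
        · exact h2 (by rw [h, neg_zero])
      · simp only [Finset.insert_subset_iff, Finset.singleton_subset_iff, Finset.mem_filter,
          Finset.mem_univ, true_and] at h
        obtain ⟨h3, h4⟩ := h
        simp only [exampleCoord, Matrix.cons_val] at h3 h4
        rcases le_total (u 2) 0 with h | h
        · exact h3 (max_eq_right h)
        · exact h4 (max_eq_right (neg_nonpos.mpr h))
    · have : exampleCoord u i = 0 := by simpa using hi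
      show (∑ i, exampleCoord u i)⁻¹ * exampleCoord u i = 0
      rw [this, mul_zero]
  obtain ⟨z₀, -⟩ := hex (fun _ => 1) (fun h => one_ne_zero (congrFun h 0))
  have : Nonempty (realization exampleComplex) := ⟨z₀⟩
  choose! ζ hζ using hex
  refine ⟨ζ, ?_, fun u hu => ?_⟩
  · have hind : Topology.IsInducing fun z : realization exampleComplex => (z.1 : Fin 5 → ℝ) :=
      Topology.IsInducing.subtypeVal.comp Topology.IsInducing.subtypeVal
    rw [hind.continuousOn_iff]
    have hc : ContinuousOn (fun u => fun i => (∑ i, exampleCoord u i)⁻¹ * exampleCoord u i)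
        {(0 : Fin 3 → ℝ)}ᶜ := by
      have hcoord : ∀ i, Continuous fun u => exampleCoord u i := fun i =>
        (continuous_apply i).comp continuous_exampleCoord
      refine continuousOn_pi.mpr fun i => ContinuousOn.mul (ContinuousOn.inv₀ ?_ ?_) ?_
      · exact (continuous_finsetSum _ fun i _ => hcoord i).continuousOn
      · exact fun u hu => (hpos u hu).ne'
      · exact (hcoord i).continuousOn
    exact hc.congr fun u hu => funext (hζ u hu)
  · have h := hζ u hu
    have h34 : exampleCoord u 3 * exampleCoord u 4 = 0 := by
      simp only [exampleCoord, Matrix.cons_val]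
      rcases le_total (u 2) 0 with h | h <;> simp [h]
    ext j
    fin_cases j
    · show (ζ u).1 0 + (ζ u).1 3 * (ζ u).1 4 - (ζ u).1 2 = _
      rw [h, h, h, h, mul_mul_mul_comm, h34, mul_zero, add_zero, ← mul_sub]
      simp [exampleCoord]
    · show (ζ u).1 1 - (ζ u).1 2 = _
      rw [h, h, ← mul_sub]
      simp [exampleCoord]
    · show (ζ u).1 3 - (ζ u).1 4 = _
      rw [h, h, ← mul_sub, exampleCoord_three_sub_four u]
      rfl

theorem not_wedgeInclHasRightHomotopyInverse_exampleComplex :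
    ¬ WedgeInclHasRightHomotopyInverse exampleComplex := by
  obtain ⟨ζ, hζ, hgζ⟩ := exists_exampleMap_section
  refine not_wedgeInclHasRightHomotopyInverse exampleMap exampleMap_ne_zero exampleDir_ne_zero
    exampleMap_deleteIncl_ne fun b => ?_
  refine not_homotopic_const_suspMap exampleMap exampleMap_ne_zero _ ?_ ?_ norm_le_sum_exampleCoord
    hζ hgζ b
  · exact continuous_finsetSum _ fun i _ => (continuous_apply i).comp continuous_exampleCoord
  · simp [exampleCoord, Fin.sum_univ_five]

theorem not_extractible_exampleComplex : ¬ Extractible 5 exampleComplex := by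
  rintro (⟨i, hi⟩ | ⟨-, h⟩)
  · exact delete_exampleComplex_ne_top i hi
  · exact not_wedgeInclHasRightHomotopyInverse_exampleComplex h

end HGolod

theorem mainTheorem10 :
    (∀ (m : ℕ) (K : AbstractSimplicialComplex (Fin (m + 1))),
      HGolod.IsNeighbourly ((m + 1) / 2) K →
        HGolod.CoherentlyHomotopyGolod (m + 1) K ∧
          ∃ Ψ : C(HGolod.SuspHatW m K, HGolod.Smash (m + 1)),
            HGolod.IsExplicitMap K Ψ ∧ HGolod.IsCoherentMap K Ψ) ∧
    HGolod.IsNeighbourly (5 / 2) HGolod.exampleComplex ∧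
    HGolod.CoherentlyHomotopyGolod 5 HGolod.exampleComplex ∧
    ¬ HGolod.Extractible 5 HGolod.exampleComplex :=
  ⟨fun _ K hK => ⟨hK.coherentlyHomotopyGolod, HGolod.psiMap K, HGolod.isExplicitMap_psiMap K,
    HGolod.isCoherentMap_psiMap hK⟩, HGolod.isNeighbourly_exampleComplex,
    HGolod.isNeighbourly_exampleComplex.coherentlyHomotopyGolod,
    HGolod.not_extractible_exampleComplex⟩
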